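/- Let $S$ be a closed oriented surface of genus at least two with a $\mathbb{CP}^1$-structure, given by a developing pair $(f,\rho)$: with $\tilde C$ the universal cover of $S$, $f\colon\tilde C\to\mathbb{CP}^1$ is a local homeomorphism and $\rho\colon\pi_1(S)\to\mathrm{PSL}(2,\mathbb{C})$ is a homomorphism with $f\circ\alpha=\rho(\alpha)\circ f$ for all $\alpha\in\pi_1(S)$, where $\pi_1(S)$ acts on $\tilde C$ by deck transformations. An open round disk in $\mathbb{CP}^1=\mathbb{C}\cup\{\infty\}$ is an open disk bounded by a circle in $\mathbb{C}$ or by a straight line together with $\infty$. A round disk in $\tilde C$ is an open subset $D\subset\tilde C$ that $f$ embeds onto an open round disk in $\mathbb{CP}^1$; it is a maximal disk if no round disk in $\tilde C$ strictly contains it. The ideal points of a maximal disk $D$ are the points of $\overline{f(D)}\setminus f(\overline{D})$, where $\overline{D}$ is the closure of $D$ in $\tilde C$; they lie on the boundary circle of $f(D)$. The core $\mathrm{Core}(D)\subset D$ is the hyperbolic convex hull of the ideal points of $D$, where $D\cong f(D)$ is conformally identified with the hyperbolic plane and the boundary circle of $f(D)$ with its circle at infinity. Then for any two distinct maximal disks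 $D_1,D_2$ in $\tilde C$ the cores $\mathrm{Core}(D_1)$ and $\mathrm{Core}(D_2)$ are disjoint, and the union of the cores of all maximal disks in $\tilde C$ is $\tilde C$. -/

import Mathlib

open Set

noncomputable section

/-- The Riemann sphere `ℂP¹ = ℂ ∪ {∞}`. -/
abbrev CP1 : Type := OnePoint ℂ

/-- `PSL(2, ℂ)`, realised as the group of transformations of `ℂP¹` induced by `SL(2, ℂ)`
(fractional linear transformations). -/
def PSL2C : Subgroup (Equiv.Perm CP1) :=
  ((MulAction.toPermHom (GL (Fin 2) ℂ) CP1).comp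
    (Matrix.SpecialLinearGroup.toGL :
      Matrix.SpecialLinearGroup (Fin 2) ℂ →* GL (Fin 2) ℂ)).range

/-- The open round disks of `ℂP¹`: the two sides of a round circle of `ℂ`, and the sides of a
straight line of `ℂ` completed by `∞`. -/
def IsRoundDisk (U : Set CP1) : Prop :=
  (∃ (c : ℂ) (r : ℝ), 0 < r ∧ U = (fun z : ℂ => (z : CP1)) '' Metric.ball c r) ∨
  (∃ (c : ℂ) (r : ℝ), 0 < r ∧ U = ((fun z : ℂ => (z : CP1)) '' Metric.closedBall c r)ᶜ) ∨
  (∃ (a : ℂ) (t : ℝ), a ≠ 0 ∧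
    U = (fun z : ℂ => (z : CP1)) '' {z : ℂ | t < (starRingEnd ℂ a * z).re})

/-- The unit disk, as a subset of `ℂP¹`. -/
def unitDisk : Set CP1 := (fun z : ℂ => (z : CP1)) '' Metric.ball (0 : ℂ) 1

/-- The isomorphism from the Poincaré model of the hyperbolic plane to the Klein model, both on the
unit disk: it restricts to the identity on the unit circle, and it sends hyperbolic geodesics to
Euclidean chords. -/
def poincareToKlein (z : ℂ) : ℂ := (2 / (1 + ‖z‖ ^ 2) : ℝ) • z

/-- The hyperbolic convex hull, in the Poincaré unit disk, of a set `A` of points of the unit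
circle (the circle at infinity). As geodesics of the Klein model are Euclidean chords, hyperbolic
convexity is Euclidean convexity there. -/
def hyperbolicHull (A : Set ℂ) : Set ℂ :=
  {z : ℂ | ‖z‖ < 1 ∧ poincareToKlein z ∈ convexHull ℝ A}

section Surface

variable {S X : Type*} [TopologicalSpace S] [TopologicalSpace X]

/-- The group of deck transformations of `p : X → S`; if `p` is the universal covering, this is
the fundamental group of `S` acting on the universal cover. -/
def deckGroup (p : X → S) : Subgroup (X ≃ₜ X) where
  carrier := {h | ∀ x, p (h x) = p x}
  mul_mem' := by
    intro a b ha hb x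
    exact (ha (b x)).trans (hb x)
  one_mem' := by
    intro x
    rfl
  inv_mem' := by
    intro a ha x
    have h := ha (a⁻¹ x)
    have h2 : a (a⁻¹ x) = x := a.apply_symm_apply x
    rw [h2] at h
    exact h.symm

/-- A `ℂP¹`-structure on `S`, with universal covering `p : X → S`, given by a developing pair:
a local homeomorphism `dev : X → ℂP¹` that is equivariant with respect to a homomorphism
`hol : π₁(S) → PSL(2, ℂ)`. -/
structure DevelopingPair (p : X → S) where
  dev : X → CP1
  hol : deckGroup p →* PSL2C
  isLocalHomeomorph_dev : IsLocalHomeomorph dev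
  equivariant : ∀ (γ : deckGroup p) (x : X),
    dev ((γ : X ≃ₜ X) x) = (hol γ : Equiv.Perm CP1) (dev x)

variable (S) in
/-- The closed orientable surface `S` has genus `g`: its first homology group with integer
coefficients, the abelianised fundamental group, has rank `2 g`. -/
def HasGenus (g : ℕ) : Prop :=
  ∀ x : S, Module.finrank ℤ (Additive (Abelianization (FundamentalGroup S x))) = 2 * g

variable (f : X → CP1)

/-- A round disk of `X` with respect to the developing map `f`: an open subset that `f` embeds onto
an open round disk of `ℂP¹` (in particular it is homeomorphic to an open disk). -/
def IsDiskOf (D : Set X) : Prop :=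
  IsOpen D ∧ Topology.IsEmbedding (fun x : D => f x) ∧ IsRoundDisk (f '' D)

/-- The maximal disks of `X`: the round disks that no round disk strictly contains. -/
def maximalDisks : Set (Set X) :=
  {D | IsDiskOf f D ∧ ∀ E, IsDiskOf f E → ¬ D ⊂ E}

/-- The ideal points of `D`: the points of the closed round disk `closure (f '' D)` that are not
in the image of the closure of `D` in `X`. They lie on the boundary circle of `f '' D`. -/
def idealPoints (D : Set X) : Set CP1 :=
  closure (f '' D) \ f '' closure D

/-- The core of `D`: the points of `D` that, under a conformal identification `φ` of the Poincaré
unit disk with `D ≅ f '' D`, lie in the hyperbolic convex hull of the ideal points of `D`. -/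
def core (D : Set X) : Set X :=
  {x | x ∈ D ∧ ∃ φ ∈ PSL2C, φ '' unitDisk = f '' D ∧
    ∃ z ∈ hyperbolicHull {w : ℂ | φ (w : CP1) ∈ idealPoints f D}, φ (z : CP1) = f x}

end Surface

end

/-! Cores, maximality and ideal points are compatible with post-composing f by a Möbius map
(`core_mobius_comp`, `maximalDisks_mobius_comp`, `idealPoints_mobius_comp`), so a given point x may
be assumed to satisfy f x = ∞. A round disk through x then has as image the complement of a closed
Euclidean disk, and x lies in its core exactly when the centre of that Euclidean disk lies in the
Euclidean convex hull of the ideal points (`exists_center_mem_convexHull_of_mem_core`,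
`mem_core_of_center_mem_convexHull`). Both claims become statements about smallest enclosing disks
in the plane.

Disjointness: f is injective on the union of two round disks that meet, so the ideal points of one
avoid the image of the other. If x lies in both cores, `sq_add_dist_sq_le_of_mem_convexHull` applied
in both directions shows that the two complementary Euclidean disks have the same centre and radius;
injectivity then identifies the two round disks.

Covering: f is injective on the union U of all round disks through x. The complement K of f(U) is a
compact subset of ℂ, and the exterior of its smallest enclosing disk lifts to a round disk D in U.
The centre is in the hull of the contact points (`exists_closedBall_center_mem_convexHull`), and
these are ideal points of D: a preimage in the closure of D would lie in another round disk through
x (`exists_isDiskOf_of_mem_closure`), hence in U. Minimality of the enclosing disk gives maximality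
of D.

This needs K to have at least two points, which is where the genus enters. Otherwise the universal
cover is compact, or f is injective onto the complement of a point (`compactSpace_or_injective`).
The first gives a finite fundamental group; in the second, deck transformations are translations of
ℂ and the first homology has rank at most two. Both contradict rank 2g ≥ 4
(`not_compl_singleton_subset_image`). -/

/-! ### Möbius transformations in coordinates -/

lemma toPerm_mem_PSL2C (g : GL (Fin 2) ℂ) : MulAction.toPermHom (GL (Fin 2) ℂ) CP1 g ∈ PSL2C := by
  -- Scalar matrices act trivially, so g may be divided by a square root of its determinant.
  obtain ⟨s, hs⟩ := IsAlgClosed.exists_pow_nat_eq g.val.det (n := 2) two_pos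
  have hg : g.val.det ≠ 0 := g.det_ne_zero
  have hs0 : s ≠ 0 := by rintro rfl; simp [← hs] at hg
  have hdet : (s⁻¹ • g.val).det = 1 := by
    rw [Matrix.det_smul, ← hs, Fintype.card_fin, ← mul_pow, inv_mul_cancel₀ hs0, one_pow]
  obtain ⟨A, hA⟩ : ∃ A : Matrix.SpecialLinearGroup (Fin 2) ℂ, A.val = s⁻¹ • g.val :=
    ⟨⟨_, hdet⟩, rfl⟩
  have hA' (i j : Fin 2) : Matrix.SpecialLinearGroup.toGL A i j = s⁻¹ * g i j := by
    change A.val i j = _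
    rw [hA]
    rfl
  refine ⟨A, ?_⟩
  ext p
  change Matrix.SpecialLinearGroup.toGL A • p = g • p
  induction p using OnePoint.rec with
  | infty =>
    simp only [OnePoint.smul_infty_eq_ite, hA']
    simp [hs0, mul_div_mul_left]
  | coe z =>
    have h1 : s⁻¹ * g 1 0 * z + s⁻¹ * g 1 1 = s⁻¹ * (g 1 0 * z + g 1 1) := by ring
    have h2 : s⁻¹ * g 0 0 * z + s⁻¹ * g 0 1 = s⁻¹ * (g 0 0 * z + g 0 1) := by ring
    simp only [OnePoint.smul_some_eq_ite, hA', h1, h2]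
    simp [hs0, mul_div_mul_left]

/-- The fractional linear transformation `z ↦ (a z + b) / (c z + d)` of the sphere. -/
lemma exists_mobius (a b c d : ℂ) (h : a * d - b * c ≠ 0) :
    ∃ φ ∈ PSL2C, φ OnePoint.infty = (if c = 0 then OnePoint.infty else ((a / c : ℂ) : CP1)) ∧
      ∀ z : ℂ, φ z = if c * z + d = 0 then OnePoint.infty
        else (((a * z + b) / (c * z + d) : ℂ) : CP1) := by
  refine ⟨_, toPerm_mem_PSL2C (Matrix.GeneralLinearGroup.mkOfDetNeZero !![a, b; c, d]
    (by simpa [Matrix.det_fin_two] using h)), ?_, fun z => ?_⟩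
  · simp [MulAction.toPermHom_apply, OnePoint.smul_infty_eq_ite,
      Matrix.GeneralLinearGroup.mkOfDetNeZero]
  · simp [MulAction.toPermHom_apply, OnePoint.smul_some_eq_ite,
      Matrix.GeneralLinearGroup.mkOfDetNeZero]

lemma mobius_formula {φ : Equiv.Perm CP1} (hφ : φ ∈ PSL2C) : ∃ a b c d : ℂ, a * d - b * c = 1 ∧
    φ OnePoint.infty = (if c = 0 then OnePoint.infty else ((a / c : ℂ) : CP1)) ∧
      ∀ z : ℂ, φ z = if c * z + d = 0 then OnePoint.infty
        else (((a * z + b) / (c * z + d) : ℂ) : CP1) := by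
  obtain ⟨g, rfl⟩ := hφ
  refine ⟨g 0 0, g 0 1, g 1 0, g 1 1, ?_, ?_, fun z => ?_⟩
  · rw [← Matrix.det_fin_two, g.2]
  · simp only [MonoidHom.coe_comp, Function.comp_apply, MulAction.toPermHom_apply,
      MulAction.toPerm_apply, OnePoint.smul_infty_eq_ite]
    split_ifs <;> first | rfl | contradiction
  · simp only [MonoidHom.coe_comp, Function.comp_apply, MulAction.toPermHom_apply,
      MulAction.toPerm_apply, OnePoint.smul_some_eq_ite]
    split_ifs <;> first | rfl | contradiction

lemma exists_mobius_infty (q : CP1) : ∃ φ ∈ PSL2C, φ OnePoint.infty = q := by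
  induction q using OnePoint.rec with
  | infty => exact ⟨1, PSL2C.one_mem, rfl⟩
  | coe z =>
    obtain ⟨φ, h1, h2, -⟩ := exists_mobius z (-1) 1 0 (by simp)
    exact ⟨φ, h1, by simpa using h2⟩

lemma mobius_affine {φ : Equiv.Perm CP1} (hφ : φ ∈ PSL2C) (h : φ OnePoint.infty = OnePoint.infty) :
    ∃ a b : ℂ, a ≠ 0 ∧ ∀ z : ℂ, φ z = ((a * z + b : ℂ) : CP1) := by
  obtain ⟨a, b, c, d, hd, h1, h2⟩ := mobius_formula hφ
  have hc : c = 0 := by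
    by_contra hc
    simp [h, hc] at h1
  subst hc
  have had : a * d = 1 := by simpa using hd
  have hd0 : d ≠ 0 := right_ne_zero_of_mul_eq_one had
  have ha0 : a ≠ 0 := left_ne_zero_of_mul_eq_one had
  refine ⟨a / d, b / d, div_ne_zero ha0 hd0, fun z => ?_⟩
  rw [h2]
  simp only [zero_mul, zero_add, hd0, if_false]
  congr 1
  field_simp

/-! ### Round disks as positivity sets of indefinite Hermitian forms -/

/-- One side of the circle with equation `α |z|² + 2 re (β̄ z) + δ = 0`. -/
def circleSide (α δ : ℝ) (β : ℂ) : Set CP1 :=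
  {p | p.elim (0 < α)
    fun z => 0 < α * Complex.normSq z + 2 * (starRingEnd ℂ β * z).re + δ}

@[simp] lemma infty_mem_circleSide {α δ : ℝ} {β : ℂ} :
    OnePoint.infty ∈ circleSide α δ β ↔ 0 < α := Iff.rfl

@[simp] lemma coe_mem_circleSide {α δ : ℝ} {β z : ℂ} :
    (z : CP1) ∈ circleSide α δ β ↔
      0 < α * Complex.normSq z + 2 * (starRingEnd ℂ β * z).re + δ := Iff.rfl

lemma OnePoint.set_ext {A B : Set CP1} (h : OnePoint.infty ∈ A ↔ OnePoint.infty ∈ B)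
    (h' : ∀ z : ℂ, (z : CP1) ∈ A ↔ (z : CP1) ∈ B) : A = B := by
  ext p
  induction p using OnePoint.rec with
  | infty => exact h
  | coe z => exact h' z

@[simp] lemma coe_mem_coe_image {A : Set ℂ} {z : ℂ} :
    (z : CP1) ∈ (fun z : ℂ => (z : CP1)) '' A ↔ z ∈ A := by
  simp

lemma Complex.dist_sq_eq (z c : ℂ) : dist z c ^ 2 = (z.re - c.re) ^ 2 + (z.im - c.im) ^ 2 := by
  rw [dist_eq_norm, Complex.sq_norm, Complex.normSq_apply]
  simp
  ring

lemma Complex.dist_lt_iff {z c : ℂ} {r : ℝ} (hr : 0 < r) :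
    dist z c < r ↔ (z.re - c.re) ^ 2 + (z.im - c.im) ^ 2 < r ^ 2 := by
  rw [← Complex.dist_sq_eq, sq_lt_sq₀ dist_nonneg hr.le]

lemma IsRoundDisk.exists_circleSide {U : Set CP1} (hU : IsRoundDisk U) :
    ∃ (α δ : ℝ) (β : ℂ), α * δ < Complex.normSq β ∧ U = circleSide α δ β := by
  obtain (⟨c, r, hr, rfl⟩ | ⟨c, r, hr, rfl⟩ | ⟨a, t, ha, rfl⟩) := hU
  · refine ⟨-1, r ^ 2 - Complex.normSq c, c, by nlinarith, OnePoint.set_ext ?_ fun z => ?_⟩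
    · simp
    · rw [coe_mem_coe_image, coe_mem_circleSide, Metric.mem_ball, Complex.dist_lt_iff hr, ← sub_pos]
      simp only [Complex.normSq_apply, Complex.mul_re, Complex.conj_re, Complex.conj_im]
      ring_nf
  · refine ⟨1, Complex.normSq c - r ^ 2, -c, by simp; nlinarith, OnePoint.set_ext ?_ fun z => ?_⟩
    · simp
    · rw [mem_compl_iff, coe_mem_coe_image, coe_mem_circleSide, Metric.mem_closedBall, not_le,
        ← sq_lt_sq₀ hr.le dist_nonneg, Complex.dist_sq_eq, ← sub_pos]
      simp only [Complex.normSq_apply, Complex.mul_re, Complex.conj_re, Complex.conj_im, map_neg,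
        Complex.neg_re, Complex.neg_im]
      ring_nf
  · refine ⟨0, -t, a / 2, by simpa using ha, OnePoint.set_ext ?_ fun z => ?_⟩
    · simp
    · rw [coe_mem_coe_image, coe_mem_circleSide, mem_ofPred_eq, ← sub_pos]
      have : a / 2 = ((1 / 2 : ℝ) : ℂ) * a := by push_cast; ring
      simp only [this, Complex.normSq_apply, Complex.mul_re, Complex.conj_re, Complex.conj_im,
        map_mul, Complex.conj_ofReal, Complex.ofReal_re, Complex.ofReal_im, Complex.mul_im, mul_assoc]
      ring_nf

lemma isRoundDisk_circleSide {α δ : ℝ} {β : ℂ} (h : α * δ < Complex.normSq β) :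
    IsRoundDisk (circleSide α δ β) := by
  have hd : 0 < Complex.normSq β - α * δ := sub_pos.2 h
  have key (hα : α ≠ 0) : 0 < Real.sqrt (Complex.normSq β - α * δ) / |α| :=
    div_pos (Real.sqrt_pos.2 hd) (abs_pos.2 hα)
  have key2 : (Real.sqrt (Complex.normSq β - α * δ) / |α|) ^ 2 =
      (Complex.normSq β - α * δ) / α ^ 2 := by
    rw [div_pow, Real.sq_sqrt hd.le, sq_abs]
  have key3 (hα : α ≠ 0) (z : ℂ) : α * Complex.normSq z + 2 * (starRingEnd ℂ β * z).re + δ =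
      α * (dist z (((-1 / α : ℝ) : ℂ) * β) ^ 2 - (Complex.normSq β - α * δ) / α ^ 2) := by
    rw [Complex.dist_sq_eq]
    simp only [Complex.normSq_apply, Complex.mul_re, Complex.conj_re, Complex.conj_im,
      Complex.mul_im, Complex.ofReal_re, Complex.ofReal_im]
    field_simp
    ring
  rcases lt_trichotomy α 0 with hα | rfl | hα
  · refine Or.inl ⟨((-1 / α : ℝ) : ℂ) * β, _, key hα.ne, OnePoint.set_ext ?_ fun z => ?_⟩
    · simp [hα.le]
    · rw [coe_mem_coe_image, coe_mem_circleSide, Metric.mem_ball,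
        ← sq_lt_sq₀ dist_nonneg (key hα.ne).le, key2,
        key3 hα.ne]
      exact ⟨fun h => sub_neg.1 (neg_of_mul_pos_right h hα.le),
        fun h => mul_pos_of_neg_of_neg hα (sub_neg.2 h)⟩
  · refine Or.inr (Or.inr ⟨2 * β, -δ, ?_, OnePoint.set_ext ?_ fun z => ?_⟩)
    · simpa using h
    · simp
    · rw [coe_mem_coe_image, coe_mem_circleSide, mem_ofPred_eq, ← sub_pos]
      simp [Complex.mul_re, mul_assoc, ← neg_lt_iff_pos_add]
  · refine Or.inr (Or.inl ⟨((-1 / α : ℝ) : ℂ) * β, _, key hα.ne', OnePoint.set_ext ?_ fun z => ?_⟩)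
    · simp [hα]
    · rw [mem_compl_iff, coe_mem_coe_image, coe_mem_circleSide, Metric.mem_closedBall, not_le,
        ← sq_lt_sq₀ (key hα.ne').le dist_nonneg, key2, key3 hα.ne',
        mul_pos_iff_of_pos_left hα, sub_pos]

/-- A Möbius map pulls a Hermitian form back by a linear change of variables. With H the form in
homogeneous coordinates, the new coefficients are H(a, c), H(b, d) and the mixed term β'. The
discriminant is multiplied by |ad − bc|² = 1, so indefiniteness persists. -/
lemma IsRoundDisk.preimage {φ : Equiv.Perm CP1} (hφ : φ ∈ PSL2C) {U : Set CP1}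
    (hU : IsRoundDisk U) : IsRoundDisk (φ ⁻¹' U) := by
  obtain ⟨α, δ, β, h, rfl⟩ := hU.exists_circleSide
  obtain ⟨a, b, c, d, hdet, h1, h2⟩ := mobius_formula hφ
  let β' : ℂ := starRingEnd ℂ (α * a * starRingEnd ℂ b + starRingEnd ℂ β * a * starRingEnd ℂ d +
    β * starRingEnd ℂ b * c + δ * c * starRingEnd ℂ d)
  let H (u v : ℂ) : ℝ := α * Complex.normSq u + 2 * (starRingEnd ℂ β * u * starRingEnd ℂ v).re
    + δ * Complex.normSq v
  have hH (u v : ℂ) (hv : v ≠ 0) : ((u / v : ℂ) : CP1) ∈ circleSide α δ β ↔ 0 < H u v := by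
    have hv' : 0 < Complex.normSq v := Complex.normSq_pos.2 hv
    rw [coe_mem_circleSide, ← mul_pos_iff_of_pos_left hv']
    have e1 : Complex.normSq v * Complex.normSq (u / v) = Complex.normSq u := by
      rw [← map_mul, mul_div_cancel₀ _ hv]
    have e2 : Complex.normSq v * (starRingEnd ℂ β * (u / v)).re =
        (starRingEnd ℂ β * u * starRingEnd ℂ v).re := by
      rw [← Complex.re_ofReal_mul, ← Complex.mul_conj]
      congr 1
      field_simp
    have : Complex.normSq v * (α * Complex.normSq (u / v) + 2 * (starRingEnd ℂ β * (u / v)).re + δ)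
        = H u v := by
      simp only [H]; rw [← e1, ← e2]; ring
    rw [this]
  have hinf (u : ℂ) (hu : u ≠ 0) : (OnePoint.infty : CP1) ∈ circleSide α δ β ↔ 0 < H u 0 := by
    simp [H, Complex.normSq_pos.2 hu]
  have hHd : H a c * H b d < Complex.normSq β' := by
    have e : Complex.normSq β' - H a c * H b d =
      (Complex.normSq β - α * δ) * Complex.normSq (a * d - b * c) := by
      simp only [β', H, Complex.normSq_apply, Complex.mul_re, Complex.mul_im, Complex.conj_re,
        Complex.conj_im, Complex.add_re, Complex.add_im, Complex.ofReal_re, Complex.ofReal_im,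
        Complex.sub_re, Complex.sub_im]
      ring
    rw [hdet] at e
    simp at e
    linarith
  have heq : φ ⁻¹' circleSide α δ β = circleSide (H a c) (H b d) β' := by
    refine OnePoint.set_ext ?_ fun z => ?_
    · rw [mem_preimage, h1, infty_mem_circleSide]
      split_ifs with hc
      · subst hc
        exact hinf a (by rintro rfl; simp at hdet)
      · exact hH a c hc
    · have e : H (a * z + b) (c * z + d) = H a c * Complex.normSq z +
          2 * (starRingEnd ℂ β' * z).re + H b d := by
        simp only [β', H, Complex.normSq_apply, Complex.mul_re, Complex.mul_im, Complex.conj_re,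
          Complex.conj_im, Complex.add_re, Complex.add_im, Complex.ofReal_re, Complex.ofReal_im]
        ring
      rw [mem_preimage, h2, coe_mem_circleSide, ← e]
      split_ifs with hc
      · rw [hc]
        refine hinf _ fun h0 => ?_
        have : (a * d - b * c) * 1 = 0 := by linear_combination a * hc - c * h0
        simp [hdet] at this
      · exact hH _ _ hc
  rw [heq]
  exact isRoundDisk_circleSide hHd

lemma IsRoundDisk.image {φ : Equiv.Perm CP1} (hφ : φ ∈ PSL2C) {U : Set CP1}
    (hU : IsRoundDisk U) : IsRoundDisk (φ '' U) := by
  rw [φ.image_eq_preimage_symm]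
  exact hU.preimage (PSL2C.inv_mem hφ)

lemma IsRoundDisk.isOpen {U : Set CP1} (hU : IsRoundDisk U) : IsOpen U := by
  obtain (⟨c, r, hr, rfl⟩ | ⟨c, r, hr, rfl⟩ | ⟨a, t, ha, rfl⟩) := hU
  · exact OnePoint.isOpen_image_coe.2 Metric.isOpen_ball
  · exact OnePoint.isOpen_compl_image_coe.2 ⟨Metric.isClosed_closedBall, isCompact_closedBall c r⟩
  · exact OnePoint.isOpen_image_coe.2 (isOpen_lt continuous_const (by fun_prop))

lemma IsRoundDisk.exists_compl_closedBall {U : Set CP1} (hU : IsRoundDisk U)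
    (h : OnePoint.infty ∈ U) :
    ∃ (c : ℂ) (r : ℝ), 0 < r ∧ U = ((fun z : ℂ => (z : CP1)) '' Metric.closedBall c r)ᶜ := by
  obtain (⟨c, r, hr, rfl⟩ | h | ⟨a, t, ha, rfl⟩) := hU
  · simp at h
  · exact h
  · simp at h

lemma IsRoundDisk.exists_convex {U : Set CP1} (hU : IsRoundDisk U) (h : OnePoint.infty ∉ U) :
    ∃ V : Set ℂ, Convex ℝ V ∧ IsOpen V ∧ U = (fun z : ℂ => (z : CP1)) '' V := by
  obtain (⟨c, r, hr, rfl⟩ | ⟨c, r, hr, rfl⟩ | ⟨a, t, ha, rfl⟩) := hU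
  · exact ⟨_, convex_ball c r, Metric.isOpen_ball, rfl⟩
  · simp at h
  · refine ⟨_, ?_, isOpen_lt continuous_const (by fun_prop), rfl⟩
    exact convex_halfSpace_gt (f := fun z : ℂ => (starRingEnd ℂ a * z).re)
      ⟨by intros; simp; ring, by intros; simp; ring⟩ t

lemma exists_isRoundDisk_subset {O : Set CP1} (hO : IsOpen O) {q : CP1} (hq : q ∈ O) :
    ∃ U, IsRoundDisk U ∧ q ∈ U ∧ U ⊆ O := by
  induction q using OnePoint.rec with
  | infty =>
    obtain ⟨-, h⟩ := (OnePoint.isOpen_iff_of_mem hq).1 hO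
    obtain ⟨r, hr⟩ := h.isBounded.subset_closedBall 0
    refine ⟨_, Or.inr (Or.inl ⟨0, max r 1, by positivity, rfl⟩), by simp, ?_⟩
    rw [compl_subset_comm]
    intro p hp
    induction p using OnePoint.rec with
    | infty => exact absurd hq hp
    | coe z => exact ⟨z, Metric.closedBall_subset_closedBall (le_max_left r 1) (hr hp), rfl⟩
  | coe z =>
    obtain ⟨r, hr, h⟩ := Metric.isOpen_iff.1 (hO.preimage OnePoint.continuous_coe) z hq
    refine ⟨_, Or.inl ⟨z, r, hr, rfl⟩, by simpa using hr, ?_⟩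
    rintro _ ⟨w, hw, rfl⟩
    exact h hw

/-- Round disks form a basis of the topology and are preserved under preimages. -/
lemma continuous_mobius {φ : Equiv.Perm CP1} (hφ : φ ∈ PSL2C) : Continuous φ := by
  refine continuous_def.2 fun O hO => isOpen_iff_forall_mem_open.2 fun p hp => ?_
  obtain ⟨U, hU, hpU, hUO⟩ := exists_isRoundDisk_subset hO hp
  exact ⟨φ ⁻¹' U, preimage_mono hUO, (hU.preimage hφ).isOpen, hpU⟩

/-- A fractional linear transformation, as a homeomorphism of the sphere. -/
def mobiusHomeomorph {φ : Equiv.Perm CP1} (hφ : φ ∈ PSL2C) : CP1 ≃ₜ CP1 where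
  toEquiv := φ
  continuous_toFun := continuous_mobius hφ
  continuous_invFun := continuous_mobius (PSL2C.inv_mem hφ)

/-! ### Connectedness of intersections of round disks -/

/-- A slightly larger concentric circle still lies in V. Each point of the difference is joined to
it by a radial segment, which stays in V by convexity and off the ball because the distance to c
varies monotonically along it. -/
lemma isPreconnected_diff_closedBall {V : Set ℂ} (hV : Convex ℝ V) (hVo : IsOpen V) {c : ℂ} {r : ℝ}
    (hr : 0 ≤ r) (h : Metric.closedBall c r ⊆ V) : IsPreconnected (V \ Metric.closedBall c r) := by
  obtain ⟨δ, hδ, hδV⟩ := (isCompact_closedBall c r).exists_cthickening_subset_open hVo h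
  rw [cthickening_closedBall hδ.le hr] at hδV
  have hS : Metric.sphere c (δ + r) ⊆ V \ Metric.closedBall c r := fun z hz =>
    ⟨hδV (Metric.sphere_subset_closedBall hz), by
      rw [Metric.mem_sphere] at hz
      rw [Metric.mem_closedBall, hz]
      linarith⟩
  have hSc : IsPreconnected (Metric.sphere c (δ + r)) :=
    isPreconnected_sphere (by simp) c _
  have h0 : c + ((δ + r : ℝ) : ℂ) ∈ Metric.sphere c (δ + r) := by
    simp [abs_of_nonneg (show 0 ≤ δ + r by positivity), -Complex.ofReal_add]
  refine isPreconnected_of_forall (c + ((δ + r : ℝ) : ℂ)) fun y hy => ?_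
  have hyr : r < ‖y - c‖ := by simpa [dist_eq_norm] using hy.2
  have hy0 : 0 < ‖y - c‖ := hr.trans_lt hyr
  set y' : ℂ := c + (((δ + r) / ‖y - c‖ : ℝ) : ℂ) * (y - c) with hy'
  have hy'S : y' ∈ Metric.sphere c (δ + r) := by
    rw [mem_sphere_iff_norm, hy', add_sub_cancel_left, norm_mul, Complex.norm_real,
      Real.norm_of_nonneg (by positivity), div_mul_cancel₀ _ hy0.ne']
  refine ⟨Metric.sphere c (δ + r) ∪ segment ℝ y y', union_subset hS ?_, Or.inl h0,
    Or.inr (left_mem_segment ℝ y y'), hSc.union y' hy'S (right_mem_segment ℝ y y')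
      (convex_segment y y').isPreconnected⟩
  intro w hw
  refine ⟨hV.segment_subset hy.1 (hS hy'S).1 hw, ?_⟩
  obtain ⟨a, b, ha, hb, hab, rfl⟩ := hw
  have e : a • y + b • y' - c = ((a + b * ((δ + r) / ‖y - c‖) : ℝ) : ℂ) * (y - c) := by
    have : (a : ℂ) + b = 1 := by exact_mod_cast hab
    rw [hy']
    simp only [Complex.real_smul]
    push_cast
    linear_combination c * this
  rw [Metric.mem_closedBall, not_le, dist_eq_norm, e, norm_mul, Complex.norm_real,
    Real.norm_of_nonneg (by positivity), add_mul, mul_assoc, div_mul_cancel₀ _ hy0.ne']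
  rcases ha.eq_or_lt with rfl | ha
  · have : b = 1 := by linarith
    subst this
    linarith
  · nlinarith

lemma IsRoundDisk.ne_univ {U : Set CP1} (hU : IsRoundDisk U) : ∃ q, q ∉ U := by
  by_cases h : OnePoint.infty ∈ U
  · obtain ⟨c, r, hr, rfl⟩ := hU.exists_compl_closedBall h
    exact ⟨c, by simp [hr.le]⟩
  · exact ⟨_, h⟩

lemma isPreconnected_of_image_mobius {φ : Equiv.Perm CP1} (hφ : φ ∈ PSL2C) {A : Set CP1}
    (h : IsPreconnected (φ ⁻¹' A)) : IsPreconnected A := by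
  rw [← φ.image_preimage A]
  exact h.image _ (continuous_mobius hφ).continuousOn

/-- If the disks miss a common point, sending it to ∞ makes both convex. Otherwise they cover the
sphere; sending a point outside U to ∞ makes the intersection a convex set minus a closed ball. -/
lemma IsRoundDisk.isPreconnected_inter {U V : Set CP1} (hU : IsRoundDisk U) (hV : IsRoundDisk V) :
    IsPreconnected (U ∩ V) := by
  by_cases hUV : ∃ q, q ∉ U ∪ V
  · obtain ⟨q, hq⟩ := hUV
    obtain ⟨φ, hφ, rfl⟩ := exists_mobius_infty q
    refine isPreconnected_of_image_mobius hφ ?_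
    obtain ⟨A, hA, -, hUA⟩ := (hU.preimage hφ).exists_convex fun h => hq (Or.inl h)
    obtain ⟨B, hB, -, hVB⟩ := (hV.preimage hφ).exists_convex fun h => hq (Or.inr h)
    rw [preimage_inter, hUA, hVB, ← image_inter OnePoint.coe_injective]
    exact (hA.inter hB).isPreconnected.image _ OnePoint.continuous_coe.continuousOn
  · push Not at hUV
    obtain ⟨q, hq⟩ := hU.ne_univ
    obtain ⟨φ, hφ, rfl⟩ := exists_mobius_infty q
    refine isPreconnected_of_image_mobius hφ ?_
    obtain ⟨A, hA, hAo, hUA⟩ := (hU.preimage hφ).exists_convex hq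
    obtain ⟨c, r, hr, hVr⟩ := (hV.preimage hφ).exists_compl_closedBall
      ((hUV _).resolve_left hq)
    have hsub : Metric.closedBall c r ⊆ A := fun z hz => by
      have h1 : (z : CP1) ∉ φ ⁻¹' V := by rw [hVr]; simpa using hz
      have h2 : (z : CP1) ∈ φ ⁻¹' U := (hUV _).resolve_right h1
      rwa [hUA, coe_mem_coe_image] at h2
    rw [preimage_inter, hUA, hVr, ← sdiff_eq, ← image_sdiff OnePoint.coe_injective]
    exact (isPreconnected_diff_closedBall hA hAo hr.le hsub).image _
      OnePoint.continuous_coe.continuousOn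

lemma IsRoundDisk.isPreconnected_diff_singleton {U : Set CP1} (hU : IsRoundDisk U) {q : CP1}
    (hq : q ∈ U) : IsPreconnected (U \ {q}) := by
  obtain ⟨φ, hφ, rfl⟩ := exists_mobius_infty q
  refine isPreconnected_of_image_mobius hφ ?_
  obtain ⟨c, r, hr, hUr⟩ := (hU.preimage hφ).exists_compl_closedBall hq
  have : φ ⁻¹' (U \ {φ OnePoint.infty}) =
      (fun z : ℂ => (z : CP1)) '' (univ \ Metric.closedBall c r) := by
    rw [preimage_sdiff, hUr]
    refine OnePoint.set_ext ?_ fun z => ?_ <;> simp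
  rw [this]
  exact (isPreconnected_diff_closedBall convex_univ isOpen_univ hr.le (subset_univ _)).image _
    OnePoint.continuous_coe.continuousOn

/-! ### Injectivity on unions, for open maps -/

section Gluing

variable {X Y : Type*} [TopologicalSpace X] [TopologicalSpace Y] [T2Space X] {f : X → Y}

/-- Values in f(A) ∩ f(B) whose preimages in A and in B coincide form an open set, and so do those
whose preimages differ, by Hausdorff separation. The two sets are disjoint and cover a connected
set, and the first is nonempty. -/
lemma injOn_union_of_isPreconnected (hf : IsOpenMap f) {A B : Set X}
    (hA : IsOpen A) (hB : IsOpen B) (iA : InjOn f A) (iB : InjOn f B)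
    (h : IsPreconnected (f '' A ∩ f '' B)) (hne : (A ∩ B).Nonempty) : InjOn f (A ∪ B) := by
  have key : ∀ a ∈ A, ∀ b ∈ B, f a = f b → a = b := by
    intro a ha b hb hab
    by_contra hne'
    let Q : Set Y := ⋃₀ {W | ∃ A' B', IsOpen A' ∧ IsOpen B' ∧ Disjoint A' B' ∧ A' ⊆ A ∧ B' ⊆ B ∧
      W = f '' A' ∩ f '' B'}
    have hQ : IsOpen Q := by
      refine isOpen_sUnion ?_
      rintro _ ⟨A', B', hA', hB', -, -, -, rfl⟩
      exact (hf _ hA').inter (hf _ hB')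
    have hQmem : ∀ a ∈ A, ∀ b ∈ B, f a = f b → a ≠ b → f a ∈ Q := by
      intro a ha b hb hab hne
      obtain ⟨u, v, hu, hv, hau, hbv, huv⟩ := t2_separation hne
      exact ⟨_, ⟨u ∩ A, v ∩ B, hu.inter hA, hv.inter hB,
        huv.mono inter_subset_left inter_subset_left, inter_subset_right, inter_subset_right, rfl⟩,
        ⟨a, ⟨hau, ha⟩, rfl⟩, ⟨b, ⟨hbv, hb⟩, hab.symm⟩⟩
    obtain ⟨w, hw⟩ := hne
    obtain ⟨z, -, ⟨c, hc, hcz⟩, ⟨W, ⟨A', B', -, -, hd, hAA, hBB, rfl⟩, ⟨a', ha', ha'z⟩, b', hb', hb'z⟩⟩ :=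
      h (f '' (A ∩ B)) Q (hf _ (hA.inter hB)) hQ (by
        rintro _ ⟨⟨a, ha, rfl⟩, b, hb, hab⟩
        by_cases e : a = b
        · exact Or.inl ⟨a, ⟨ha, e ▸ hb⟩, rfl⟩
        · exact Or.inr (hQmem a ha b hb hab.symm e))
        ⟨f w, ⟨mem_image_of_mem f hw.1, mem_image_of_mem f hw.2⟩, mem_image_of_mem f hw⟩
        ⟨f a, ⟨mem_image_of_mem f ha, b, hb, hab.symm⟩, hQmem a ha b hb hab hne'⟩
    have e1 : a' = c := iA (hAA ha') hc.1 (ha'z.trans hcz.symm)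
    have e2 : b' = c := iB (hBB hb') hc.2 (hb'z.trans hcz.symm)
    exact disjoint_left.1 hd ha' (e1.trans e2.symm ▸ hb')
  rintro a (ha | ha) b (hb | hb) hab
  · exact iA ha hb hab
  · exact key a ha b hb hab
  · exact (key b hb a ha hab.symm).symm
  · exact iB ha hb hab

/-- If y were different from the preimage u of f y in U, points of U near y would share their values
with points of U near u. -/
lemma mem_of_mem_closure_of_injOn (hf : IsOpenMap f) (hfc : Continuous f) {U : Set X}
    (hU : IsOpen U) (iU : InjOn f U) {y : X} (hy : y ∈ closure U) (hfy : f y ∈ f '' U) : y ∈ U := by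
  obtain ⟨u, hu, huy⟩ := hfy
  by_contra hyU
  obtain ⟨A, B, hA, hB, hyA, huB, hAB⟩ := t2_separation (show y ≠ u by rintro rfl; exact hyU hu)
  obtain ⟨v, ⟨hvA, b, ⟨hbB, hbU⟩, hbv⟩, hvU⟩ := mem_closure_iff.1 hy (A ∩ f ⁻¹' (f '' (B ∩ U)))
    (hA.inter ((hf _ (hB.inter hU)).preimage hfc)) ⟨hyA, u, ⟨huB, hu⟩, huy⟩
  exact disjoint_left.1 hAB hvA (iU hbU hvU hbv ▸ hbB)

end Gluing

/-! ### Round disks in the universal cover -/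

section Disks

variable {X : Type*} [TopologicalSpace X] {f : X → CP1}

lemma isDiskOf_iff (hf : IsLocalHomeomorph f) {D : Set X} :
    IsDiskOf f D ↔ IsOpen D ∧ InjOn f D ∧ IsRoundDisk (f '' D) := by
  refine and_congr_right fun hD => and_congr_left fun _ => ?_
  refine ⟨fun h => injOn_iff_injective.2 h.injective, fun h => ?_⟩
  refine (Topology.IsOpenEmbedding.of_continuous_injective_isOpenMap
    (hf.continuous.comp continuous_subtype_val) (injOn_iff_injective.1 h) ?_).isEmbedding
  exact hf.isOpenMap.comp hD.isOpenMap_subtype_val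

lemma isDiskOf_inter_preimage (hf : IsLocalHomeomorph f) {U : Set X} (hU : IsOpen U)
    (iU : InjOn f U) {W : Set CP1} (hW : IsRoundDisk W) (h : W ⊆ f '' U) :
    IsDiskOf f (U ∩ f ⁻¹' W) ∧ f '' (U ∩ f ⁻¹' W) = W := by
  have e : f '' (U ∩ f ⁻¹' W) = W := by
    rw [image_inter_preimage, inter_eq_right.2 h]
  exact ⟨(isDiskOf_iff hf).2 ⟨hU.inter (hW.isOpen.preimage hf.continuous),
    iU.mono inter_subset_left, by rwa [e]⟩, e⟩

lemma exists_isDiskOf_subset (hf : IsLocalHomeomorph f) {O : Set X} (hO : IsOpen O) {y : X}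
    (hy : y ∈ O) : ∃ E, IsDiskOf f E ∧ y ∈ E ∧ E ⊆ O := by
  obtain ⟨e, hye, rfl⟩ := hf y
  have hU : IsOpen (e.source ∩ O) := e.open_source.inter hO
  obtain ⟨W, hW, hyW, hWU⟩ := exists_isRoundDisk_subset (hf.isOpenMap _ hU)
    (mem_image_of_mem e ⟨hye, hy⟩)
  exact ⟨_, (isDiskOf_inter_preimage hf hU (e.injOn.mono inter_subset_left) hW hWU).1,
    ⟨⟨hye, hy⟩, hyW⟩, fun z hz => hz.1.2⟩

/-- The union of the round disks that contain `x`. -/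
def diskUnion (f : X → CP1) (x : X) : Set X := ⋃₀ {D | IsDiskOf f D ∧ x ∈ D}

lemma isOpen_diskUnion (x : X) : IsOpen (diskUnion f x) :=
  isOpen_sUnion fun _ h => h.1.1

lemma IsDiskOf.subset_diskUnion {D : Set X} (hD : IsDiskOf f D) {x : X} (hx : x ∈ D) :
    D ⊆ diskUnion f x := subset_sUnion_of_mem ⟨hD, hx⟩

lemma mem_diskUnion (hf : IsLocalHomeomorph f) (x : X) : x ∈ diskUnion f x := by
  obtain ⟨E, hE, hx, -⟩ := exists_isDiskOf_subset hf isOpen_univ (mem_univ x)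
  exact hE.subset_diskUnion hx hx

lemma idealPoints_subset_closure (D : Set X) : idealPoints f D ⊆ closure (f '' D) :=
  sdiff_subset

lemma notMem_image_of_mem_idealPoints {D : Set X} {k : CP1} (hk : k ∈ idealPoints f D) :
    k ∉ f '' D := fun h => hk.2 (image_mono subset_closure h)

variable [T2Space X]

lemma IsDiskOf.injOn_union (hf : IsLocalHomeomorph f) {A B : Set X} (hA : IsDiskOf f A)
    (hB : IsDiskOf f B) (h : (A ∩ B).Nonempty) : InjOn f (A ∪ B) := by
  rw [isDiskOf_iff hf] at hA hB
  exact injOn_union_of_isPreconnected hf.isOpenMap hA.1 hB.1 hA.2.1 hB.2.1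
    (hA.2.2.isPreconnected_inter hB.2.2) h

lemma injOn_diskUnion (hf : IsLocalHomeomorph f) (x : X) : InjOn f (diskUnion f x) := by
  rintro a ⟨A, ⟨hA, hxA⟩, ha⟩ b ⟨B, ⟨hB, hxB⟩, hb⟩ hab
  exact hA.injOn_union hf hB ⟨x, hxA, hxB⟩ (Or.inl ha) (Or.inr hb) hab

/-- Suppose k = f y with y in B. As k adheres to f(A), values near k are taken in A and near y in B,
at the same point by injectivity on the union. So y adheres to A, contrary to k being ideal. -/
lemma IsDiskOf.notMem_image_of_mem_idealPoints (hf : IsLocalHomeomorph f) {A B : Set X}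
    (hA : IsDiskOf f A) (hB : IsDiskOf f B) (h : (A ∩ B).Nonempty) {k : CP1}
    (hk : k ∈ idealPoints f A) : k ∉ f '' B := by
  rintro ⟨y, hy, rfl⟩
  refine hk.2 ⟨y, mem_closure_iff.2 fun N hN hyN => ?_, rfl⟩
  obtain ⟨_, ⟨b, hb, rfl⟩, a, ha, hab⟩ := mem_closure_iff.1 hk.1 (f '' (N ∩ B))
    (hf.isOpenMap _ (hN.inter hB.1)) ⟨y, ⟨hyN, hy⟩, rfl⟩
  have := hA.injOn_union hf hB h (Or.inl ha) (Or.inr hb.2) hab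
  exact ⟨a, this ▸ hb.1, ha⟩

end Disks

/-! ### Invariance under post-composition with Möbius maps -/

section Invariance

lemma inv_comp_comp {X : Type*} (ψ : Equiv.Perm CP1) (f : X → CP1) : ⇑ψ⁻¹ ∘ (ψ ∘ f) = f := by
  ext x
  simp

variable {X : Type*} [TopologicalSpace X] {f : X → CP1} {ψ : Equiv.Perm CP1}

lemma isLocalHomeomorph_mobius_comp (hψ : ψ ∈ PSL2C) (hf : IsLocalHomeomorph f) :
    IsLocalHomeomorph (ψ ∘ f) :=
  (mobiusHomeomorph hψ).isLocalHomeomorph.comp hf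

lemma IsDiskOf.mobius_comp (hψ : ψ ∈ PSL2C) {D : Set X} (h : IsDiskOf f D) :
    IsDiskOf (ψ ∘ f) D := by
  refine ⟨h.1, (mobiusHomeomorph hψ).isEmbedding.comp h.2.1, ?_⟩
  rw [image_comp]
  exact h.2.2.image hψ

lemma isDiskOf_mobius_comp (hψ : ψ ∈ PSL2C) {D : Set X} : IsDiskOf (ψ ∘ f) D ↔ IsDiskOf f D :=
  ⟨fun h => by simpa only [inv_comp_comp] using h.mobius_comp (PSL2C.inv_mem hψ),
    fun h => h.mobius_comp hψ⟩

lemma maximalDisks_mobius_comp (hψ : ψ ∈ PSL2C) : maximalDisks (ψ ∘ f) = maximalDisks f := by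
  simp only [maximalDisks, isDiskOf_mobius_comp hψ]

lemma idealPoints_mobius_comp (hψ : ψ ∈ PSL2C) (D : Set X) :
    idealPoints (ψ ∘ f) D = ψ '' idealPoints f D := by
  rw [idealPoints, idealPoints, image_sdiff ψ.injective, image_comp, image_comp]
  congr 1
  exact ((mobiusHomeomorph hψ).image_closure _).symm

lemma core_subset_core_mobius_comp (hψ : ψ ∈ PSL2C) (D : Set X) :
    core f D ⊆ core (ψ ∘ f) D := by
  rintro x ⟨hx, φ, hφ, hφD, z, hz, hzx⟩
  refine ⟨hx, ψ * φ, PSL2C.mul_mem hψ hφ, ?_, z, ?_, ?_⟩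
  · rw [Equiv.Perm.coe_mul, image_comp, hφD, image_comp]
  · simpa [idealPoints_mobius_comp hψ] using hz
  · simp [hzx]

lemma core_mobius_comp (hψ : ψ ∈ PSL2C) (D : Set X) : core (ψ ∘ f) D = core f D := by
  refine Subset.antisymm ?_ (core_subset_core_mobius_comp hψ D)
  simpa only [inv_comp_comp] using
    core_subset_core_mobius_comp (f := ψ ∘ f) (PSL2C.inv_mem hψ) D

end Invariance

/-! ### Convex hulls and smallest enclosing disks in the plane -/

/-- On the circle about c, the squared distance to c' is affine in the point: |k − c'|² = r² + |c −
c'|² + 2⟨k − c, c − c'⟩. The bound by r'² therefore extends to the convex hull, and at c the inner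
product vanishes. -/
lemma sq_add_dist_sq_le_of_mem_convexHull {T : Set ℂ} {c c' : ℂ} {r r' : ℝ}
    (hc : c ∈ convexHull ℝ T) (hT : T ⊆ Metric.sphere c r) (hT' : T ⊆ Metric.closedBall c' r') :
    r ^ 2 + dist c c' ^ 2 ≤ r' ^ 2 := by
  let ℓ : ℂ →ₗ[ℝ] ℝ := (2 * (c.re - c'.re)) • Complex.reLm + (2 * (c.im - c'.im)) • Complex.imLm
  have hℓ (z : ℂ) : ℓ z = 2 * (c.re - c'.re) * z.re + 2 * (c.im - c'.im) * z.im := by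
    simp [ℓ]
  have hconv : Convex ℝ {z | ℓ z ≤ r' ^ 2 - r ^ 2 - dist c c' ^ 2 + ℓ c} :=
    convex_halfSpace_le ℓ.isLinear _
  have hsub : T ⊆ {z | ℓ z ≤ r' ^ 2 - r ^ 2 - dist c c' ^ 2 + ℓ c} := fun k hk => by
    have h1 : dist k c ^ 2 = r ^ 2 := by rw [Metric.mem_sphere.1 (hT hk)]
    have h2 : dist k c' ^ 2 ≤ r' ^ 2 := pow_le_pow_left₀ dist_nonneg (hT' hk) 2
    rw [Complex.dist_sq_eq] at h1 h2
    rw [mem_ofPred_eq, hℓ, hℓ, Complex.dist_sq_eq]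
    nlinarith
  have := convexHull_min hsub hconv hc
  rw [mem_ofPred_eq] at this
  linarith

/-- By Carathéodory, three points suffice in the plane, so the hull is a continuous image of a
simplex times T³. -/
lemma isCompact_convexHull_complex {T : Set ℂ} (hT : IsCompact T) :
    IsCompact (convexHull ℝ T) := by
  rcases T.eq_empty_or_nonempty with rfl | ⟨k₀, hk₀⟩
  · simp
  let F : (Fin 3 → ℝ) × (Fin 3 → ℂ) → ℂ := fun q => ∑ i, q.1 i • q.2 i
  have hF : Continuous F := by fun_prop
  suffices convexHull ℝ T = F '' (stdSimplex ℝ (Fin 3) ×ˢ univ.pi fun _ => T) by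
    rw [this]
    exact ((isCompact_stdSimplex ℝ (Fin 3)).prod (isCompact_univ_pi fun _ => hT)).image hF
  refine Subset.antisymm (fun x hx => ?_) ?_
  · obtain ⟨ι, _, z, w, hz, hind, hw, hw1, rfl⟩ := eq_pos_convex_span_of_mem_convexHull hx
    have hcard : Fintype.card ι ≤ Fintype.card (Fin 3) := by
      simpa [Complex.finrank_real_complex] using hind.card_le_finrank_succ.trans
        (Nat.succ_le_succ (Submodule.finrank_le _))
    obtain ⟨e⟩ := Function.Embedding.nonempty_of_card_le hcard
    -- Unused indices receive weight 0 and the dummy point k₀.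
    refine ⟨(Function.extend e w 0, Function.extend e z fun _ => k₀), ⟨⟨fun i => ?_, ?_⟩, ?_⟩, ?_⟩
    · by_cases hi : ∃ j, e j = i
      · obtain ⟨j, rfl⟩ := hi
        simpa [e.injective.extend_apply] using (hw j).le
      · simp [Function.extend_apply' _ _ _ hi]
    · rw [← hw1]
      exact (Fintype.sum_of_injective e e.injective _ _
        (fun i hi => by simp [Function.extend_apply' _ _ _ hi])
        fun j => by simp [e.injective.extend_apply]).symm
    · intro i _
      by_cases hi : ∃ j, e j = i
      · obtain ⟨j, rfl⟩ := hi
        simpa [e.injective.extend_apply] using hz ⟨j, rfl⟩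
      · simpa [Function.extend_apply' _ _ _ hi] using hk₀
    · exact (Fintype.sum_of_injective e e.injective _ _
        (fun i hi => by simp [Function.extend_apply' _ _ _ hi])
        fun j => by simp [e.injective.extend_apply]).symm
  · rintro _ ⟨⟨w, z⟩, ⟨⟨hw, hw1⟩, hz⟩, rfl⟩
    exact (convex_convexHull ℝ T).sum_mem (fun i _ => hw i) hw1
      fun i _ => subset_convexHull ℝ T (hz i (mem_univ i))

/-- The smallest disk enclosing a compact set `K`: its centre is in the convex hull of the points of
`K` on the bounding circle. -/
lemma exists_closedBall_center_mem_convexHull {K : Set ℂ} (hK : IsCompact K) (hne : K.Nonempty) :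
    ∃ (c : ℂ) (r : ℝ), 0 ≤ r ∧ K ⊆ Metric.closedBall c r ∧
      c ∈ convexHull ℝ (K ∩ Metric.sphere c r) := by
  obtain ⟨k₀, hk₀⟩ := hne
  obtain ⟨R, hR⟩ := hK.isBounded.subset_closedBall k₀
  have hR0 : 0 ≤ R := dist_nonneg.trans (hR hk₀)
  -- the pairs (centre, radius) of enclosing disks of radius at most `R`
  let P : Set (ℂ × ℝ) := {q | q.2 ∈ Icc 0 R ∧ ∀ k ∈ K, dist k q.1 ≤ q.2}
  have hPc : IsClosed P := by
    have : P = {q | q.2 ∈ Icc 0 R} ∩ ⋂ k ∈ K, {q : ℂ × ℝ | dist k q.1 ≤ q.2} := by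
      ext q; simp [P]
    rw [this]
    exact (isClosed_Icc.preimage continuous_snd).inter
      (isClosed_biInter fun k _ => isClosed_le (by fun_prop) (by fun_prop))
  have hPb : P ⊆ Metric.closedBall k₀ R ×ˢ Icc 0 R := fun q hq =>
    ⟨by rw [Metric.mem_closedBall, dist_comm]; exact (hq.2 k₀ hk₀).trans hq.1.2, hq.1⟩
  have hPcomp : IsCompact P :=
    ((isCompact_closedBall k₀ R).prod isCompact_Icc).of_isClosed_subset hPc hPb
  obtain ⟨⟨c, r⟩, ⟨hr, hcr⟩, hmin⟩ := hPcomp.exists_isMinOn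
    ⟨(k₀, R), ⟨hR0, le_rfl⟩, fun k hk => hR hk⟩ continuous_snd.continuousOn
  have hmin' : ∀ (c' : ℂ) (r' : ℝ), 0 ≤ r' → K ⊆ Metric.closedBall c' r' → r ≤ r' := by
    intro c' r' hr' h
    by_contra! hlt
    exact absurd (hmin (show (c', r') ∈ P from ⟨⟨hr', hlt.le.trans hr.2⟩, fun k hk => h hk⟩))
      (not_le.2 hlt)
  refine ⟨c, r, hr.1, hcr, ?_⟩
  by_contra hcT
  have hTc : IsCompact (K ∩ Metric.sphere c r) := hK.inter_right Metric.isClosed_sphere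
  -- If c were outside the hull, a line would separate it from the contact points. Moving c slightly
  -- along the gradient u of ℓ would then give a smaller enclosing disk.
  obtain ⟨ℓ, t, hℓc, hℓt⟩ := geometric_hahn_banach_point_closed
    (convex_convexHull ℝ (K ∩ Metric.sphere c r)) (isCompact_convexHull_complex hTc).isClosed hcT
  have hℓ (z : ℂ) : ℓ z = z.re * ℓ 1 + z.im * ℓ Complex.I := by
    conv_lhs => rw [← Complex.re_add_im z, map_add, ← mul_one (z.re : ℂ), ← Complex.real_smul,
      ← Complex.real_smul, map_smul, map_smul]
    rfl
  set u : ℂ := ⟨ℓ 1, ℓ Complex.I⟩ with hu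
  obtain ⟨ρ, hρ, hKρ⟩ : ∃ ρ < r, ∀ k ∈ K, ℓ k ≤ t → dist k c ≤ ρ := by
    have hK' : IsCompact (K ∩ {k | ℓ k ≤ t}) :=
      hK.inter_right (isClosed_le ℓ.continuous continuous_const)
    rcases (K ∩ {k | ℓ k ≤ t}).eq_empty_or_nonempty with h | h
    · exact ⟨r - 1, by linarith, fun k hk hkt => absurd (show k ∈ K ∩ {k | ℓ k ≤ t} from ⟨hk, hkt⟩)
        (h ▸ notMem_empty k)⟩
    · obtain ⟨k, ⟨hk, hkt⟩, hmax⟩ := hK'.exists_isMaxOn h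
        (f := fun k => dist k c) (by fun_prop)
      refine ⟨dist k c, lt_of_le_of_ne (hcr k hk) fun hkr => ?_, fun k hk hkt => hmax ⟨hk, hkt⟩⟩
      exact absurd (hℓt k (subset_convexHull ℝ _ ⟨hk, hkr⟩)) (not_lt.2 hkt)
  -- The bound on ε‖u‖ controls points with ℓ k ≤ t, which have slack r − ρ. The bound on ε‖u‖²
  -- makes the gain 2ε(ℓ k − ℓ c) exceed the loss ε²‖u‖² at the other points.
  obtain ⟨ε, hε, hε1, hε2⟩ : ∃ ε > 0, ε * ‖u‖ ^ 2 < t - ℓ c ∧ ε * ‖u‖ < r - ρ := by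
    have h1 : Filter.Tendsto (fun ε : ℝ => ε * ‖u‖ ^ 2) (nhds 0) (nhds 0) := by
      simpa using (continuous_mul_const (‖u‖ ^ 2)).tendsto (0 : ℝ)
    have h2 : Filter.Tendsto (fun ε : ℝ => ε * ‖u‖) (nhds 0) (nhds 0) := by
      simpa using (continuous_mul_const ‖u‖).tendsto (0 : ℝ)
    obtain ⟨ε, ⟨h1, h2⟩, h3⟩ := (((h1.eventually_lt_const (sub_pos.2 hℓc)).and
      (h2.eventually_lt_const (sub_pos.2 hρ))).filter_mono nhdsWithin_le_nhds |>.and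
      (self_mem_nhdsWithin (s := Ioi (0 : ℝ)))).exists
    exact ⟨ε, h3, h1, h2⟩
  have hlt : ∀ k ∈ K, dist k (c + ε • u) < r := by
    intro k hk
    by_cases hkt : ℓ k ≤ t
    · calc dist k (c + ε • u) ≤ dist k c + dist c (c + ε • u) := dist_triangle _ _ _
        _ ≤ ρ + ε * ‖u‖ := by
          gcongr
          · exact hKρ k hk hkt
          · rw [dist_self_add_right, norm_smul, Real.norm_of_nonneg (le_of_lt hε)]
        _ < r := by linarith
    · have h1 : dist k c ^ 2 ≤ r ^ 2 := pow_le_pow_left₀ dist_nonneg (hcr k hk) 2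
      have h2 : ‖u‖ ^ 2 = (ℓ 1) ^ 2 + (ℓ Complex.I) ^ 2 := by
        rw [Complex.sq_norm, Complex.normSq_apply]; ring
      refine lt_of_pow_lt_pow_left₀ 2 hr.1 ?_
      rw [Complex.dist_sq_eq] at h1 ⊢
      simp only [Complex.add_re, Complex.add_im, Complex.smul_re, Complex.smul_im, hu, smul_eq_mul]
      push Not at hkt
      rw [hℓ k] at hkt
      rw [hℓ c] at hε1
      rw [h2] at hε1
      nlinarith [mul_lt_mul_of_pos_left hε1 hε, mul_lt_mul_of_pos_left hkt hε,
        sq_nonneg (ε * ℓ 1), sq_nonneg (ε * ℓ Complex.I)]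
  obtain ⟨k, hk, hmax⟩ := hK.exists_isMaxOn ⟨k₀, hk₀⟩
    (f := fun k => dist k (c + ε • u)) (by fun_prop)
  exact absurd (hmin' (c + ε • u) _ dist_nonneg hmax) (not_le.2 (hlt k hk))

/-- The Möbius map a ↦ (1 − z̄a)/(a − z) sends z to ∞ and preserves the unit circle. Reweighting a
convex combination by |a − z|² clears denominators: on the circle each term becomes w(ā − 2z̄ +
z̄²a). The total vanishes exactly because the original combination is the Klein point of z. -/
lemma zero_mem_convexHull_of_poincareToKlein_mem {A B : Set ℂ} {z : ℂ}
    (hA : ∀ a ∈ A, Complex.normSq a = 1)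
    (h : poincareToKlein z ∈ convexHull ℝ A)
    (hB : ∀ a ∈ A, a ≠ z ∧ (1 - starRingEnd ℂ z * a) / (a - z) ∈ B) : (0 : ℂ) ∈ convexHull ℝ B := by
  obtain ⟨ι, _, a, w, ha, -, hw, hw1, hsum⟩ := eq_pos_convex_span_of_mem_convexHull h
  have ha' (i : ι) : a i ∈ A := ha ⟨i, rfl⟩
  let b (i : ι) : ℂ := (1 - starRingEnd ℂ z * a i) / (a i - z)
  let μ (i : ι) : ℝ := w i * Complex.normSq (a i - z)
  have hμ (i : ι) : 0 < μ i :=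
    mul_pos (hw i) (Complex.normSq_pos.2 (sub_ne_zero.2 (hB _ (ha' i)).1))
  have hι : Nonempty ι := by
    by_contra hι
    rw [not_nonempty_iff] at hι
    simp at hw1
  have hmem := (convex_convexHull ℝ B).centerMass_mem (t := Finset.univ) (w := μ) (z := b)
    (fun i _ => (hμ i).le) (Finset.sum_pos (fun i _ => hμ i) Finset.univ_nonempty)
    fun i _ => subset_convexHull ℝ B (hB _ (ha' i)).2
  have hterm (i : ι) : μ i • b i = starRingEnd ℂ (w i • a i) -
      (w i : ℂ) * (2 * starRingEnd ℂ z) + starRingEnd ℂ z ^ 2 * (w i • a i) := by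
    have h1 : a i - z ≠ 0 := sub_ne_zero.2 (hB _ (ha' i)).1
    have h2 : a i * starRingEnd ℂ (a i) = 1 := by
      rw [Complex.mul_conj, hA _ (ha' i), Complex.ofReal_one]
    have h3 : μ i • b i = w i * ((1 - starRingEnd ℂ z * a i) * starRingEnd ℂ (a i - z)) := by
      simp only [μ, b, Complex.real_smul, Complex.ofReal_mul, ← Complex.mul_conj]
      field_simp
    rw [h3]
    simp only [Complex.real_smul, map_mul, Complex.conj_ofReal, map_sub]
    linear_combination -(w i : ℂ) * starRingEnd ℂ z * h2
  have hsum0 : ∑ i, μ i • b i = 0 := by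
    have hw1' : ∑ i, (w i : ℂ) = 1 := by exact_mod_cast hw1
    simp only [hterm, Finset.sum_add_distrib, Finset.sum_sub_distrib]
    rw [← map_sum, ← Finset.sum_mul, ← Finset.mul_sum, hsum, hw1', poincareToKlein,
      Complex.real_smul, map_mul, Complex.conj_ofReal]
    have h4 : ((2 / (1 + ‖z‖ ^ 2) : ℝ) : ℂ) * (1 + z * starRingEnd ℂ z) = 2 := by
      rw [Complex.mul_conj, Complex.normSq_eq_norm_sq, ← Complex.ofReal_one, ← Complex.ofReal_add,
        ← Complex.ofReal_mul, div_mul_cancel₀ _ (by positivity)]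
      simp
    linear_combination starRingEnd ℂ z * h4
  rwa [Finset.centerMass, hsum0, smul_zero] at hmem

/-! ### The core seen from a point sent to infinity -/

section Core

variable {X : Type*} [TopologicalSpace X] {f : X → CP1} {D : Set X} {c : ℂ} {r : ℝ}

lemma exists_coe_of_mem_idealPoints
    (hD : f '' D = ((fun z : ℂ => (z : CP1)) '' Metric.closedBall c r)ᶜ) {k : CP1}
    (hk : k ∈ idealPoints f D) : ∃ w : ℂ, k = w ∧ dist w c = r := by
  have h1 := notMem_image_of_mem_idealPoints hk
  rw [hD, notMem_compl_iff] at h1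
  obtain ⟨w, hw, rfl⟩ := h1
  refine ⟨w, rfl, le_antisymm hw (not_lt.1 fun hlt => ?_)⟩
  obtain ⟨_, ⟨v, hv, rfl⟩, hv'⟩ := mem_closure_iff.1 (idealPoints_subset_closure D hk)
    ((fun z : ℂ => (z : CP1)) '' Metric.ball c r)
    (OnePoint.isOpen_image_coe.2 Metric.isOpen_ball) ⟨w, hlt, rfl⟩
  rw [hD] at hv'
  exact hv' ⟨v, Metric.ball_subset_closedBall hv, rfl⟩

lemma convex_preimage_affine {E : Set ℂ} (hE : Convex ℝ E) (a b : ℂ) :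
    Convex ℝ {w | a * w + b ∈ E} := by
  intro x hx y hy s t hs ht hst
  have hst' : (s : ℂ) + t = 1 := by exact_mod_cast hst
  have e : a * (s • x + t • y) + b = s • (a * x + b) + t • (a * y + b) := by
    simp only [Complex.real_smul]
    linear_combination -b * hst'
  rw [mem_ofPred_eq, e]
  exact hE hx hy hs ht hst

lemma convex_preimage_conj {E : Set ℂ} (hE : Convex ℝ E) :
    Convex ℝ {w | starRingEnd ℂ w ∈ E} := by
  intro x hx y hy s t hs ht hst
  have e : starRingEnd ℂ (s • x + t • y) = s • starRingEnd ℂ x + t • starRingEnd ℂ y := by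
    simp [Complex.real_smul]
  rw [mem_ofPred_eq, e]
  exact hE hx hy hs ht hst

/-- If `f x = ∞` and `x` lies in the core of `D`, then the centre of the circle bounding `f '' D` is
in the Euclidean convex hull of the ideal points. -/
lemma exists_center_mem_convexHull_of_mem_core {x : X} (hfx : f x = OnePoint.infty)
    (hx : x ∈ core f D) : ∃ (c : ℂ) (r : ℝ), 0 < r ∧
      f '' D = ((fun z : ℂ => (z : CP1)) '' Metric.closedBall c r)ᶜ ∧
      c ∈ convexHull ℝ {w : ℂ | (w : CP1) ∈ idealPoints f D} := by
  obtain ⟨hxD, φ, hφ, hφD, z, ⟨hz, hzA⟩, hzx⟩ := hx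
  have hz1 : Complex.normSq z < 1 := by
    rw [Complex.normSq_eq_norm_sq]
    nlinarith [norm_nonneg z]
  -- The map w ↦ (zw + 1)/(w + z̄) takes the exterior of the unit disk to the unit disk and ∞ to z.
  -- Hence φ ∘ m fixes ∞ and is affine, w ↦ aw + b, so the bounding circle has centre b and radius
  -- |a|.
  obtain ⟨m, hm, hm1, hm2⟩ := exists_mobius z 1 1 (starRingEnd ℂ z) (by
    rw [Complex.mul_conj, mul_one, ← Complex.ofReal_one, ← Complex.ofReal_sub,
      Complex.ofReal_ne_zero]
    linarith)
  obtain ⟨a, b, ha, hab⟩ := mobius_affine (PSL2C.mul_mem hφ hm) (by simp [hm1, hzx, hfx])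
  have hab' (w : ℂ) : φ (m w) = ((a * w + b : ℂ) : CP1) := hab w
  have hnorm (w : ℂ) : Complex.normSq (w + starRingEnd ℂ z) - Complex.normSq (z * w + 1) =
      (Complex.normSq w - 1) * (1 - Complex.normSq z) := by
    simp only [Complex.normSq_apply, Complex.add_re, Complex.add_im, Complex.mul_re, Complex.mul_im,
      Complex.conj_re, Complex.conj_im, Complex.one_re, Complex.one_im]
    ring
  have hdist (w : ℂ) : dist (a * w + b) b = ‖a‖ * ‖w‖ := by
    rw [dist_eq_norm, add_sub_cancel_right, norm_mul]
  have hsurj (v : ℂ) : ∃ w, v = a * w + b := ⟨(v - b) / a, by field_simp; ring⟩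
  have ha0 : 0 < ‖a‖ := norm_pos_iff.2 ha
  have hmem (w : ℂ) : m w ∈ unitDisk ↔ 1 < ‖w‖ := by
    have e : 1 < ‖w‖ ↔ Complex.normSq (z * w + 1) < Complex.normSq (w + starRingEnd ℂ z) := by
      rw [← sub_pos (b := Complex.normSq (z * w + 1)), hnorm,
        mul_pos_iff_of_pos_right (sub_pos.2 hz1), sub_pos, Complex.normSq_eq_norm_sq,
        one_lt_sq_iff₀ (norm_nonneg w)]
    rw [hm2, e]
    simp only [one_mul]
    split_ifs with h0
    · simp [unitDisk, h0, Complex.normSq_nonneg]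
    · rw [unitDisk, coe_mem_coe_image, mem_ball_zero_iff, norm_div, div_lt_one (norm_pos_iff.2 h0),
        Complex.normSq_eq_norm_sq, Complex.normSq_eq_norm_sq,
        sq_lt_sq₀ (norm_nonneg _) (norm_nonneg _)]
  have hD : f '' D = ((fun z : ℂ => (z : CP1)) '' Metric.closedBall b ‖a‖)ᶜ := by
    refine OnePoint.set_ext ?_ fun v => ?_
    · simpa using ⟨x, hxD, hfx⟩
    · obtain ⟨w, rfl⟩ := hsurj v
      rw [← hφD, ← hab', φ.injective.mem_set_image, hmem, hab', mem_compl_iff, coe_mem_coe_image,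
        Metric.mem_closedBall, hdist, not_le, lt_mul_iff_one_lt_right ha0]
  refine ⟨b, ‖a‖, ha0, hD, ?_⟩
  have hw {α : ℂ} (hα : φ (α : CP1) ∈ idealPoints f D) : ∃ w : ℂ, Complex.normSq w = 1 ∧
      w + starRingEnd ℂ z ≠ 0 ∧ α = (z * w + 1) / (w + starRingEnd ℂ z) ∧
      ((a * w + b : ℂ) : CP1) ∈ idealPoints f D := by
    obtain ⟨v, hv, hvd⟩ := exists_coe_of_mem_idealPoints hD hα
    obtain ⟨w, rfl⟩ := hsurj v
    rw [hdist] at hvd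
    have hw1 : ‖w‖ = 1 := by
      have : ‖a‖ * ‖w‖ = ‖a‖ * 1 := by rw [hvd, mul_one]
      exact mul_left_cancel₀ ha0.ne' this
    rw [← hab'] at hv
    have h3 := φ.injective hv
    rw [hm2] at h3
    simp only [one_mul] at h3
    split_ifs at h3 with h0
    · simp at h3
    · refine ⟨w, by rw [Complex.normSq_eq_norm_sq, hw1, one_pow], h0, OnePoint.coe_injective h3, ?_⟩
      rwa [← hab', ← hv]
  have h0 : (0 : ℂ) ∈ convexHull ℝ {w : ℂ | ((a * w + b : ℂ) : CP1) ∈ idealPoints f D} := by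
    have hsph : ∀ α ∈ {w : ℂ | φ w ∈ idealPoints f D}, Complex.normSq α = 1 := by
      intro α hα
      obtain ⟨w, hw1, hw0, rfl, -⟩ := hw hα
      have := hnorm w
      rw [hw1, sub_self, zero_mul, sub_eq_zero] at this
      rw [map_div₀, this, div_self]
      rw [← this]
      exact (Complex.normSq_pos.2 hw0).ne'
    refine zero_mem_convexHull_of_poincareToKlein_mem hsph hzA fun α hα => ?_
    have hαz : α ≠ z := by
      rintro rfl
      exact hz1.ne (hsph _ hα)
    refine ⟨hαz, ?_⟩
    obtain ⟨w, hw1, hw0, hαw, hwi⟩ := hw hα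
    rw [eq_div_iff hw0] at hαw
    have : (1 - starRingEnd ℂ z * α) / (α - z) = w := by
      rw [div_eq_iff (sub_ne_zero.2 hαz)]
      linear_combination -hαw
    rw [this]
    exact hwi
  have := convexHull_min (t := {w | a * w + b ∈ convexHull ℝ {w : ℂ | (w : CP1) ∈ idealPoints f D}})
    (fun w hw => subset_convexHull ℝ _ hw) (convex_preimage_affine (convex_convexHull ℝ _) a b) h0
  simpa using this

lemma mem_core_of_center_mem_convexHull {x : X} (hfx : f x = OnePoint.infty) (hx : x ∈ D)
    (hr : 0 < r) (hD : f '' D = ((fun z : ℂ => (z : CP1)) '' Metric.closedBall c r)ᶜ)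
    (hc : c ∈ convexHull ℝ {w : ℂ | (w : CP1) ∈ idealPoints f D}) : x ∈ core f D := by
  have hr' : (r : ℂ) ≠ 0 := Complex.ofReal_ne_zero.2 hr.ne'
  -- The chart u ↦ c + r/u sends 0 to ∞, so x corresponds to the origin, where the Poincaré and
  -- Klein models agree.
  obtain ⟨φ, hφ, -, hφ2⟩ := exists_mobius c r 1 0 (by simpa using hr')
  have hφ0 : φ ((0 : ℂ) : CP1) = OnePoint.infty := by simp [hφ2]
  have hφu {u : ℂ} (hu : u ≠ 0) : φ u = ((c + r / u : ℂ) : CP1) := by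
    rw [hφ2]
    simp only [one_mul, add_zero, if_neg hu]
    congr 1
    field_simp
  refine ⟨hx, φ, hφ, ?_, 0, ⟨by simp, ?_⟩, by rw [hφ0, hfx]⟩
  · rw [hD]
    refine OnePoint.set_ext ?_ fun v => ?_
    · rw [← hφ0, φ.injective.mem_set_image, hφ0]
      simp [unitDisk]
    · rw [mem_compl_iff, coe_mem_coe_image, Metric.mem_closedBall, not_le, dist_eq_norm]
      constructor
      · rintro ⟨_, ⟨u, hu, rfl⟩, huv⟩
        rcases eq_or_ne u 0 with rfl | hu0
        · simp [hφ0] at huv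
        · dsimp only at huv
          rw [hφu hu0, OnePoint.coe_eq_coe] at huv
          rw [← huv, add_sub_cancel_left, norm_div, Complex.norm_real, Real.norm_of_nonneg hr.le,
            lt_div_iff₀ (norm_pos_iff.2 hu0)]
          rw [mem_ball_zero_iff] at hu
          nlinarith
      · intro h
        have hv : v - c ≠ 0 := norm_pos_iff.1 (hr.trans h)
        refine ⟨_, ⟨r / (v - c), ?_, rfl⟩, ?_⟩
        · rw [mem_ball_zero_iff, norm_div, Complex.norm_real, Real.norm_of_nonneg hr.le,
            div_lt_one (norm_pos_iff.2 hv)]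
          exact h
        · dsimp only
          rw [hφu (div_ne_zero hr' hv)]
          congr 1
          field_simp
          ring
  -- On the bounding circle the inverse chart r/(k − c) equals the conjugate of (k − c)/r. This
  -- expression is real-affine in k, so it carries the hull to the hull and c to 0.
  · have e : poincareToKlein 0 = starRingEnd ℂ ((r : ℂ)⁻¹ * c + -(r : ℂ)⁻¹ * c) := by
      simp [poincareToKlein]
    rw [e]
    refine convexHull_min (s := {w : ℂ | (w : CP1) ∈ idealPoints f D}) (fun k hk => ?_)
      (convex_preimage_affine (convex_preimage_conj (convex_convexHull ℝ _)) _ _) hc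
    refine subset_convexHull ℝ _ ?_
    obtain ⟨k', hk', hkd⟩ := exists_coe_of_mem_idealPoints hD hk
    obtain rfl := OnePoint.coe_injective hk'
    have hkc : starRingEnd ℂ (k - c) ≠ 0 := by
      rw [Ne, map_eq_zero, sub_eq_zero, ← dist_eq_zero, hkd]
      exact hr.ne'
    have h1 : starRingEnd ℂ ((r : ℂ)⁻¹ * k + -(r : ℂ)⁻¹ * c) = starRingEnd ℂ (k - c) / r := by
      simp
      ring
    have h2 : (k - c) * starRingEnd ℂ (k - c) = r ^ 2 := by
      rw [Complex.mul_conj, Complex.normSq_eq_norm_sq, ← dist_eq_norm, hkd]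
      push_cast
      rfl
    rw [mem_ofPred_eq, h1, hφu (div_ne_zero hkc hr')]
    have h3 : c + r / (starRingEnd ℂ (k - c) / r) = k := by
      field_simp
      linear_combination -h2
    rwa [h3]

end Core

/-! ### Disjointness and covering -/

section Cores

variable {X : Type*} [TopologicalSpace X] [T2Space X] {f : X → CP1}

lemma eq_of_mem_core_of_eq_infty (hf : IsLocalHomeomorph f) {D₁ D₂ : Set X} (h₁ : IsDiskOf f D₁)
    (h₂ : IsDiskOf f D₂) {x : X} (hfx : f x = OnePoint.infty) (hx₁ : x ∈ core f D₁)
    (hx₂ : x ∈ core f D₂) : D₁ = D₂ := by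
  obtain ⟨c₁, r₁, hr₁, hD₁, hc₁⟩ := exists_center_mem_convexHull_of_mem_core hfx hx₁
  obtain ⟨c₂, r₂, hr₂, hD₂, hc₂⟩ := exists_center_mem_convexHull_of_mem_core hfx hx₂
  have hne : (D₁ ∩ D₂).Nonempty := ⟨x, hx₁.1, hx₂.1⟩
  have key {A B : Set X} (hA : IsDiskOf f A) (hB : IsDiskOf f B) (hAB : (A ∩ B).Nonempty)
      {c r c' r'} (hAr : f '' A = ((fun z : ℂ => (z : CP1)) '' Metric.closedBall c r)ᶜ)
      (hBr : f '' B = ((fun z : ℂ => (z : CP1)) '' Metric.closedBall c' r')ᶜ)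
      (hc : c ∈ convexHull ℝ {w : ℂ | (w : CP1) ∈ idealPoints f A}) :
      r ^ 2 + dist c c' ^ 2 ≤ r' ^ 2 := by
    refine sq_add_dist_sq_le_of_mem_convexHull hc (fun w hw => ?_) fun w hw => ?_
    · obtain ⟨v, hv, hvd⟩ := exists_coe_of_mem_idealPoints hAr hw
      rw [OnePoint.coe_injective hv]
      exact hvd
    · have := hA.notMem_image_of_mem_idealPoints hf hB hAB hw
      rwa [hBr, notMem_compl_iff, coe_mem_coe_image] at this
  have k1 := key h₁ h₂ hne hD₁ hD₂ hc₁
  have k2 := key h₂ h₁ (inter_comm D₁ D₂ ▸ hne) hD₂ hD₁ hc₂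
  have hd : dist c₁ c₂ = 0 := by
    rw [dist_comm c₂ c₁] at k2
    nlinarith
  rw [dist_comm, hd] at k2
  rw [hd] at k1
  have hr : r₁ = r₂ := by
    rw [← sq_eq_sq₀ hr₁.le hr₂.le]
    linarith
  rw [dist_eq_zero] at hd
  subst hd hr
  have hi := h₁.injOn_union hf h₂ hne
  exact (hi.image_eq_image_iff subset_union_left subset_union_right).1 (hD₁.trans hD₂.symm)

lemma eq_of_mem_core (hf : IsLocalHomeomorph f) {D₁ D₂ : Set X} (h₁ : IsDiskOf f D₁)
    (h₂ : IsDiskOf f D₂) {x : X} (hx₁ : x ∈ core f D₁) (hx₂ : x ∈ core f D₂) : D₁ = D₂ := by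
  obtain ⟨φ, hφ, hφx⟩ := exists_mobius_infty (f x)
  have hψ := PSL2C.inv_mem hφ
  rw [← core_mobius_comp hψ] at hx₁ hx₂
  refine eq_of_mem_core_of_eq_infty (isLocalHomeomorph_mobius_comp hψ hf)
    (h₁.mobius_comp hψ) (h₂.mobius_comp hψ) ?_ hx₁ hx₂
  simp [← hφx]

/-- A round disk can be enlarged near a point `y` of its frontier without losing a given point. -/
lemma exists_isDiskOf_of_mem_closure (hf : IsLocalHomeomorph f) {D : Set X} (hD : IsDiskOf f D)
    {x y : X} (hx : x ∈ D) (hfx : f x = OnePoint.infty) (hy : y ∈ closure D) :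
    ∃ E, IsDiskOf f E ∧ x ∈ E ∧ y ∈ E := by
  by_cases hyD : y ∈ D
  · exact ⟨D, hD, hx, hyD⟩
  obtain ⟨c, r, hr, hDr⟩ := hD.2.2.exists_compl_closedBall ⟨x, hx, hfx⟩
  have hyD' : f y ∉ f '' D := fun h => hyD (mem_of_mem_closure_of_injOn hf.isOpenMap hf.continuous
    hD.1 ((isDiskOf_iff hf).1 hD).2.1 hy h)
  rw [hDr, notMem_compl_iff] at hyD'
  obtain ⟨k, hk, hky⟩ := hyD'
  have hkr : dist k c = r := by
    refine le_antisymm hk (not_lt.1 fun hlt => ?_)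
    obtain ⟨v, hv, hvD⟩ := mem_closure_iff.1 hy
      (f ⁻¹' ((fun z : ℂ => (z : CP1)) '' Metric.ball c r))
      ((OnePoint.isOpen_image_coe.2 Metric.isOpen_ball).preimage hf.continuous) ⟨k, hlt, hky⟩
    have := mem_image_of_mem f hvD
    rw [hDr] at this
    exact this (image_mono Metric.ball_subset_closedBall hv)
  obtain ⟨E, hE, hyE, -⟩ := exists_isDiskOf_subset hf isOpen_univ (mem_univ y)
  have hDE : (D ∩ E).Nonempty := by
    rw [inter_comm]
    exact mem_closure_iff.1 hy E hE.1 hyE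
  have hi := hD.injOn_union hf hE hDE
  obtain ⟨ε, hε, hεE⟩ := Metric.isOpen_iff.1
    (hE.2.2.isOpen.preimage OnePoint.continuous_coe) k ⟨y, hyE, hky.symm⟩
  -- The new circle is centred at 2c − k, the reflection of k in c, with radius just below the
  -- distance 2r to k. The bound m ≤ r² keeps the radius positive; m ≤ ε² keeps the added cap inside
  -- f(E).
  set m : ℝ := min (ε ^ 2) (r ^ 2)
  have hm1 : m ≤ ε ^ 2 := min_le_left _ _
  have hm2 : m ≤ r ^ 2 := min_le_right _ _
  have hm0 : 0 < m := lt_min (by positivity) (by positivity)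
  have hρ0 : 0 < 4 * r ^ 2 - m := by nlinarith
  have hρ : 0 < √(4 * r ^ 2 - m) := Real.sqrt_pos.2 hρ0
  -- this disk contains `closedBall c r` except for a small cap around `k`
  let W : Set CP1 := ((fun z : ℂ => (z : CP1)) '' Metric.closedBall (2 * c - k) (√(4 * r ^ 2 - m)))ᶜ
  have hW : IsRoundDisk W := Or.inr (Or.inl ⟨_, _, hρ, rfl⟩)
  have hmemW (z : ℂ) : (z : CP1) ∈ W ↔ 4 * r ^ 2 - m < dist z (2 * c - k) ^ 2 := by
    rw [mem_compl_iff, coe_mem_coe_image, Metric.mem_closedBall, not_le,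
      Real.sqrt_lt hρ0.le dist_nonneg]
  -- By the parallelogram law, a point of W within r of c is at distance less than √m from k.
  have hsq (z : ℂ) : dist z (2 * c - k) ^ 2 = 2 * dist z c ^ 2 + 2 * r ^ 2 - dist z k ^ 2 := by
    rw [← hkr]
    simp only [Complex.dist_sq_eq, Complex.sub_re, Complex.sub_im, Complex.mul_re, Complex.mul_im,
      Complex.re_ofNat, Complex.im_ofNat]
    ring
  have hWDE : W ⊆ f '' (D ∪ E) := by
    rw [image_union, hDr]
    intro p hp
    induction p using OnePoint.rec with
    | infty => exact Or.inl (by simp)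
    | coe z =>
      by_cases hz : dist z c ≤ r
      · right
        refine hεE ?_
        rw [hmemW, hsq] at hp
        have h1 : dist z c ^ 2 ≤ r ^ 2 := pow_le_pow_left₀ dist_nonneg hz 2
        exact lt_of_pow_lt_pow_left₀ 2 hε.le (by linarith)
      · exact Or.inl (by simpa using hz)
  refine ⟨_, (isDiskOf_inter_preimage hf (hD.1.union hE.1) hi hW hWDE).1, ⟨Or.inl hx, ?_⟩,
    Or.inr hyE, ?_⟩
  · rw [mem_preimage, hfx]
    simp [W]
  · rw [mem_preimage, ← hky]
    refine (hmemW k).2 ?_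
    rw [hsq, hkr, dist_self]
    linarith

lemma exists_mem_core_of_eq_infty (hf : IsLocalHomeomorph f)
    (h : ∀ U : Set X, IsOpen U → InjOn f U → ∀ q, ¬ {q}ᶜ ⊆ f '' U) {x : X}
    (hfx : f x = OnePoint.infty) : ∃ D ∈ maximalDisks f, x ∈ core f D := by
  have hUo := isOpen_diskUnion (f := f) x
  have hUi := injOn_diskUnion hf x
  set U := diskUnion f x with hU
  have hxU : x ∈ U := mem_diskUnion hf x
  let K : Set ℂ := {w | (w : CP1) ∉ f '' U}
  have hinf : OnePoint.infty ∈ f '' U := ⟨x, hxU, hfx⟩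
  have hK : IsCompact K := ((OnePoint.isOpen_iff_of_mem hinf).1 (hf.isOpenMap _ hUo)).2
  have hKne : K.Nonempty := by
    by_contra hK0
    refine h U hUo hUi OnePoint.infty fun p hp => ?_
    induction p using OnePoint.rec with
    | infty => simp at hp
    | coe z => 
      by_contra hz
      exact hK0 ⟨z, hz⟩
  obtain ⟨c, r, hr, hKr, hc⟩ := exists_closedBall_center_mem_convexHull hK hKne
  -- Radius zero would mean that K is the single point c, which is excluded by `h`.
  have hr0 : 0 < r := by
    refine hr.lt_of_ne fun hr0 => ?_
    subst hr0
    refine h U hUo hUi c fun p hp => ?_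
    induction p using OnePoint.rec with
    | infty => exact ⟨x, hxU, hfx⟩
    | coe z =>
      by_contra hz
      have := hKr (show z ∈ K from hz)
      simp at this
      exact hp (by rw [this]; rfl)
  let W : Set CP1 := ((fun z : ℂ => (z : CP1)) '' Metric.closedBall c r)ᶜ
  have hW : IsRoundDisk W := Or.inr (Or.inl ⟨c, r, hr0, rfl⟩)
  have hWU : W ⊆ f '' U := by
    rw [← compl_subset_compl, compl_compl]
    intro p hp
    induction p using OnePoint.rec with
    | infty => exact absurd ⟨x, hxU, hfx⟩ hp
    | coe z => exact ⟨z, hKr hp, rfl⟩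
  obtain ⟨hD, hDW⟩ := isDiskOf_inter_preimage hf hUo hUi hW hWU
  have hxW : f x ∈ W := by simp [W, hfx]
  set D := U ∩ f ⁻¹' W
  have hxD : x ∈ D := ⟨hxU, hxW⟩
  refine ⟨D, ⟨hD, fun E hE hDE => ?_⟩, mem_core_of_center_mem_convexHull hfx hxD hr0 hDW ?_⟩
  · have hEU := hE.subset_diskUnion (hDE.1 hxD)
    obtain ⟨c', r', hr', hEr⟩ := hE.2.2.exists_compl_closedBall ⟨x, hDE.1 hxD, hfx⟩
    have hK' : K ⊆ Metric.closedBall c' r' := fun w hw => by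
      have : (w : CP1) ∉ f '' E := fun h => hw (image_mono hEU h)
      rwa [hEr, notMem_compl_iff, coe_mem_coe_image] at this
    have hle := sq_add_dist_sq_le_of_mem_convexHull hc inter_subset_right
      (inter_subset_left.trans hK')
    have hsub : Metric.closedBall c' r' ⊆ Metric.closedBall c r := by
      have := image_mono (f := f) hDE.1
      rw [hDW, hEr, compl_subset_compl, image_subset_image_iff OnePoint.coe_injective] at this
      exact this
    -- The ends c' ± r' of a diameter both lie in the ball of radius r. Together with `hle`, r² + |c
    -- − c'|² ≤ r'², this forces equal centres and radii.
    have hrr : r' ≤ r := by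
      have h1 : dist (c' + r') c ≤ r := hsub (by simp [abs_of_pos hr'])
      have h2 : dist (c' - r') c ≤ r := hsub (by simp [abs_of_pos hr'])
      have h3 : dist (c' + r') (c' - r') = 2 * r' := by
        rw [dist_eq_norm, show c' + r' - (c' - r') = ((2 * r' : ℝ) : ℂ) by push_cast; ring,
          Complex.norm_real, Real.norm_of_nonneg (by positivity)]
      linarith [dist_triangle_right (c' + r') (c' - r') c]
    have hcc : dist c c' = 0 := by nlinarith [dist_nonneg (x := c) (y := c')]
    have hrr' : r = r' := by nlinarith [sq_nonneg (dist c c')]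
    rw [dist_eq_zero] at hcc
    subst hcc hrr'
    exact hDE.ne ((hUi.image_eq_image_iff inter_subset_left hEU).1 (hDW.trans hEr.symm))
  · refine convexHull_mono ?_ hc
    rintro k ⟨hk, hkr⟩
    rw [Metric.mem_sphere] at hkr
    refine ⟨?_, ?_⟩
    · rw [hDW]
      have h1 : k ∈ closure (Metric.closedBall c r)ᶜ := by
        rw [closure_compl, interior_closedBall c hr0.ne', mem_compl_iff, Metric.mem_ball, hkr]
        exact lt_irrefl r
      refine closure_mono ?_ (image_closure_subset_closure_image OnePoint.continuous_coe
        (mem_image_of_mem _ h1))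
      rintro _ ⟨w, hw, rfl⟩
      simpa [W] using hw
    -- A preimage of the contact point in the closure of D would lie in a round disk through x,
    -- hence in U, but K misses f(U).
    · rintro ⟨y, hy, hyk⟩
      obtain ⟨E, hE, hxE, hyE⟩ := exists_isDiskOf_of_mem_closure hf hD hxD hfx hy
      exact hk ⟨y, hE.subset_diskUnion hxE hyE, hyk⟩

lemma exists_mem_core (hf : IsLocalHomeomorph f)
    (h : ∀ U : Set X, IsOpen U → InjOn f U → ∀ q, ¬ {q}ᶜ ⊆ f '' U) (x : X) :
    ∃ D ∈ maximalDisks f, x ∈ core f D := by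
  obtain ⟨φ, hφ, hφx⟩ := exists_mobius_infty (f x)
  have hψ := PSL2C.inv_mem hφ
  obtain ⟨D, hD, hx⟩ := exists_mem_core_of_eq_infty (isLocalHomeomorph_mobius_comp hψ hf)
    (fun U hU hi q hq => h U hU (fun a ha b hb hab => hi ha hb (congrArg (φ⁻¹ : Equiv.Perm CP1) hab)) (φ q)
      fun p hp => by
        obtain ⟨u, hu, hup⟩ := hq (show (φ⁻¹ : Equiv.Perm CP1) p ∈ ({q}ᶜ : Set CP1) from fun hpq => hp (by
          rw [mem_singleton_iff] at hpq ⊢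
          rw [← hpq]
          simp))
        exact ⟨u, hu, (φ⁻¹ : Equiv.Perm CP1).injective hup⟩) (x := x) (by simp [← hφx])
  exact ⟨D, by rwa [maximalDisks_mobius_comp hψ] at hD, by rwa [core_mobius_comp hψ] at hx⟩

end Cores

/-! ### Developing images that miss at most one point -/

section Compactness

variable {X : Type*} [TopologicalSpace X] [T2Space X] [ConnectedSpace X] {f : X → CP1}

/-- U is homeomorphic to the sphere, hence compact and therefore clopen in the connected space X. -/
lemma compactSpace_of_image_eq_univ (hf : IsLocalHomeomorph f) {U : Set X} (hU : IsOpen U)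
    (hi : InjOn f U) (h : f '' U = univ) : CompactSpace X := by
  have he : Topology.IsOpenEmbedding (U.domRestrict f) :=
    .of_continuous_injective_isOpenMap (hf.continuous.comp continuous_subtype_val)
      (injOn_iff_injective.1 hi) (hf.isOpenMap.comp hU.isOpenMap_subtype_val)
  have hs : Function.Surjective (U.domRestrict f) := by
    rw [← range_eq_univ, range_domRestrict, h]
  have hc : CompactSpace U := (he.toHomeomorphOfSurjective hs).symm.compactSpace
  have hUc : IsCompact U := isCompact_iff_compactSpace.2 hc
  have hne : U.Nonempty := by
    rw [← image_nonempty (f := f), h]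
    exact univ_nonempty
  rw [IsClopen.eq_univ ⟨hUc.isClosed, hU⟩ hne] at hUc
  exact ⟨hUc⟩

/-- If f(U) omits q and U is not closed, an added frontier point must map to q. A round disk E
around it glues injectively to U, since f(E) minus q is connected, and the union maps onto the
sphere. -/
lemma compactSpace_or_injective (hf : IsLocalHomeomorph f) {U : Set X} (hU : IsOpen U)
    (hi : InjOn f U) {q : CP1} (h : {q}ᶜ ⊆ f '' U) :
    CompactSpace X ∨ (Function.Injective f ∧ range f = {q}ᶜ) := by
  by_cases hq : q ∈ f '' U
  · refine Or.inl (compactSpace_of_image_eq_univ hf hU hi (eq_univ_of_forall fun p => ?_))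
    by_cases hp : p = q
    · exact hp ▸ hq
    · exact h hp
  have hUq : f '' U = {q}ᶜ := Subset.antisymm (fun p hp hpq => hq (by
    rw [mem_singleton_iff] at hpq; exact hpq ▸ hp)) h
  have hne : U.Nonempty := by
    rw [← image_nonempty (f := f), hUq]
    obtain ⟨p, hp⟩ := exists_ne q
    exact ⟨p, hp⟩
  by_cases hcl : closure U ⊆ U
  · right
    have : U = univ := IsClopen.eq_univ ⟨closure_subset_iff_isClosed.1 hcl, hU⟩ hne
    subst this
    exact ⟨injOn_univ.1 hi, by rw [← image_univ, hUq]⟩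
  · left
    obtain ⟨y, hy, hyU⟩ := not_subset.1 hcl
    have hfy : f y = q := by
      by_contra hfy
      exact hyU (mem_of_mem_closure_of_injOn hf.isOpenMap hf.continuous hU hi hy (h hfy))
    obtain ⟨E, hE, hyE, -⟩ := exists_isDiskOf_subset hf isOpen_univ (mem_univ y)
    have hE' := (isDiskOf_iff hf).1 hE
    refine compactSpace_of_image_eq_univ hf (hE.1.union hU)
      (injOn_union_of_isPreconnected hf.isOpenMap hE.1 hU hE'.2.1 hi ?_
        (mem_closure_iff.1 hy E hE.1 hyE)) (eq_univ_of_forall fun p => ?_)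
    · rw [hUq, ← sdiff_eq]
      exact hE.2.2.isPreconnected_diff_singleton ⟨y, hyE, hfy⟩
    · rw [image_union]
      by_cases hp : p = q
      · exact Or.inl (hp ▸ ⟨y, hyE, hfy⟩)
      · exact Or.inr (h hp)

end Compactness

/-! ### Fundamental groups, monodromy and deck transformations -/

section Covering

variable {S X : Type*} [TopologicalSpace S] [TopologicalSpace X] {p : X → S}

/-- A lift of γ that closes up is null-homotopic in the simply connected cover, and projects to γ.
-/
lemma IsCoveringMap.eq_one_of_monodromy_eq [SimplyConnectedSpace X] (hp : IsCoveringMap p) {s : S}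
    {γ : FundamentalGroup S s} {e : p ⁻¹' {s}} (h : hp.monodromyPerm s γ e = e) : γ = 1 := by
  obtain ⟨e, rfl⟩ := e
  have h1 := hp.map_liftPathQuotient γ ⟨e, rfl⟩
  have h2 : (hp.monodromy γ ⟨e, rfl⟩).1 = e := congrArg Subtype.val h
  have h3 : (hp.liftPathQuotient γ ⟨e, rfl⟩).cast rfl h2.symm = Path.Homotopic.Quotient.refl e :=
    Subsingleton.elim _ _
  have h4 := congrArg (fun Γ => Path.Homotopic.Quotient.map Γ ⟨p, hp.continuous⟩) h3
  simp only [Path.Homotopic.Quotient.map_cast, h1] at h4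
  exact (Path.Homotopic.Quotient.cast_rfl_rfl γ).symm.trans
    ((Path.Homotopic.Quotient.cast_cast γ _ _ _ _).symm.trans h4)

/-- A deck transformation carries lifts of γ to lifts of γ. -/
lemma IsCoveringMap.monodromy_deck (hp : IsCoveringMap p) {s : S} (γ : FundamentalGroup S s)
    {d : X ≃ₜ X} (hd : d ∈ deckGroup p) {e e' : p ⁻¹' {s}} (h : (e' : X) = d e) :
    (hp.monodromyPerm s γ e' : X) = d (hp.monodromyPerm s γ e) := by
  let d' : C(X, X) := ⟨d, d.continuous⟩
  let p' : C(X, S) := ⟨p, hp.continuous⟩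
  have hdp : p'.comp d' = p' := by ext x; exact hd x
  have hm : p (d (hp.monodromy γ e)) = s := (hd _).trans (hp.monodromy γ e).2
  obtain ⟨e', he'⟩ := e'
  obtain rfl : e' = d e := h
  have := hp.monodromy_eq_of_map_eq (γ := γ) (ex := ⟨d e, he'⟩) (ey := ⟨d (hp.monodromy γ e), hm⟩)
    ((hp.liftPathQuotient γ e).map d') (by
      change Path.Homotopic.Quotient.map _ p' = _
      rw [← Path.Homotopic.Quotient.map_comp]
      convert hp.map_liftPathQuotient γ e using 2
      · exact hd _
      · exact hd _
      · grind)
  exact congrArg Subtype.val this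

lemma exists_deck (hp : IsCoveringMap p) [SimplyConnectedSpace X] [LocallyPathConnectedSpace X]
    {e e' : X} (h : p e = p e') : ∃ d ∈ deckGroup p, d e = e' := by
  obtain ⟨F, ⟨hF, hpF⟩, -⟩ := hp.existsUnique_continuousMap_lifts ⟨p, hp.continuous⟩ e e' h.symm
  obtain ⟨G, ⟨hG, hpG⟩, -⟩ := hp.existsUnique_continuousMap_lifts ⟨p, hp.continuous⟩ e' e h
  have hGF : ⇑G ∘ F = id := hp.eq_of_comp_eq (by fun_prop) continuous_id (by
    ext x
    exact (congrFun hpG (F x)).trans (congrFun hpF x)) e (by simp [hF, hG])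
  have hFG : ⇑F ∘ G = id := hp.eq_of_comp_eq (by fun_prop) continuous_id (by
    ext x
    exact (congrFun hpF (G x)).trans (congrFun hpG x)) e' (by simp [hF, hG])
  exact ⟨⟨⟨F, G, congrFun hGF, congrFun hFG⟩, F.continuous, G.continuous⟩, congrFun hpF, hF⟩

/-- The fibre is compact and discrete, hence finite, and the fundamental group embeds in it as an
orbit of the free monodromy action. -/
lemma finrank_abelianization_eq_zero [SimplyConnectedSpace X] [CompactSpace X] [T1Space S]
    (hp : IsCoveringMap p) (e : X) :
    Module.finrank ℤ (Additive (Abelianization (FundamentalGroup S (p e)))) = 0 := by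
  have : DiscreteTopology (p ⁻¹' {p e}) := (hp (p e)).discreteTopology_fiber
  have : CompactSpace (p ⁻¹' {p e}) := isCompact_iff_compactSpace.1
    (isClosed_singleton.preimage hp.continuous).isCompact
  have : Finite (p ⁻¹' {p e}) := finite_of_compact_of_discrete
  have hinj : Function.Injective fun γ : FundamentalGroup S (p e) =>
      hp.monodromyPerm (p e) γ ⟨e, rfl⟩ := by
    intro γ γ' h
    have : hp.monodromyPerm (p e) (γ'⁻¹ * γ) ⟨e, rfl⟩ = ⟨e, rfl⟩ := by
      rw [map_mul, Equiv.Perm.mul_apply]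
      dsimp only at h
      rw [h, ← Equiv.Perm.mul_apply, ← map_mul, inv_mul_cancel, map_one, Equiv.Perm.one_apply]
    exact (inv_mul_eq_one.1 (hp.eq_one_of_monodromy_eq this)).symm
  have : Finite (FundamentalGroup S (p e)) := Finite.of_injective _ hinj
  have : Finite (Abelianization (FundamentalGroup S (p e))) :=
    Finite.of_surjective _ (QuotientGroup.mk'_surjective _)
  have : Finite (Additive (Abelianization (FundamentalGroup S (p e)))) := this
  refine Module.IsTorsion.finrank_eq_zero fun {x} => ?_
  refine ⟨⟨Nat.card (Additive (Abelianization (FundamentalGroup S (p e)))),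
    mem_nonZeroDivisors_of_ne_zero (Int.natCast_ne_zero.2 Nat.card_pos.ne')⟩, ?_⟩
  rw [Submonoid.mk_smul, natCast_zsmul, card_nsmul_eq_zero']

/-- Sending γ to the displacement of e under monodromy, read in ℂ, is an injective homomorphism. Its
range is discrete because its translate by h e lies in the image of a fibre, and a discrete subgroup
of ℂ has rank at most two. -/
lemma finrank_abelianization_le_two [SimplyConnectedSpace X] [LocallyPathConnectedSpace X]
    [T1Space S] (hp : IsCoveringMap p) (h : X ≃ₜ ℂ)
    (ht : ∀ d ∈ deckGroup p, ∃ b, ∀ x, h (d x) = h x + b) (e : X) :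
    Module.finrank ℤ (Additive (Abelianization (FundamentalGroup S (p e)))) ≤ 2 := by
  have hfib : DiscreteTopology (p ⁻¹' {p e}) := (hp (p e)).discreteTopology_fiber
  let M := hp.monodromyPerm (p e)
  let e₀ : p ⁻¹' {p e} := ⟨e, rfl⟩
  have hM (γ : FundamentalGroup S (p e)) : ∃ d ∈ deckGroup p, d e = M γ e₀ :=
    exists_deck hp (M γ e₀).2.symm
  let φ : FundamentalGroup S (p e) →* Multiplicative ℂ :=
    { toFun := fun γ => Multiplicative.ofAdd (h (M γ e₀) - h e)
      map_one' := by rw [map_one, Equiv.Perm.one_apply, sub_self, ofAdd_zero]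
      map_mul' := fun γ γ' => by
        obtain ⟨d, hd, hde⟩ := hM γ'
        obtain ⟨b, hb⟩ := ht d hd
        -- Monodromy commutes with the deck transformation d, which acts as a translation, so
        -- displacements add.
        have h1 : (M (γ * γ') e₀ : X) = d (M γ e₀) := by
          rw [map_mul, Equiv.Perm.mul_apply]
          exact hp.monodromy_deck γ hd hde.symm
        rw [← ofAdd_add, h1, hb, ← hde, hb]
        congr 1
        ring }
  have hφ (γ) (hγ : φ γ = 1) : γ = 1 := by
    refine hp.eq_one_of_monodromy_eq (e := e₀) (Subtype.ext (h.injective ?_))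
    exact sub_eq_zero.1 (Multiplicative.ofAdd.injective hγ)
  let L : Additive (Abelianization (FundamentalGroup S (p e))) →ₗ[ℤ] ℂ :=
    (MonoidHom.toAdditiveLeft (Abelianization.lift φ)).toIntLinearMap
  have hsurj (x : Additive (Abelianization (FundamentalGroup S (p e)))) :
      ∃ γ, x = Additive.ofMul (Abelianization.of γ) := by
    obtain ⟨γ, hγ⟩ := QuotientGroup.mk'_surjective _ x.toMul
    exact ⟨γ, hγ.symm⟩
  have hLinj : Function.Injective L := by
    refine (injective_iff_map_eq_zero L).2 fun x hx => ?_
    obtain ⟨γ, rfl⟩ := hsurj x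
    rw [hφ γ (congrArg Multiplicative.ofAdd hx), map_one, ofMul_one]
  have hmem (v : LinearMap.range L) : h.symm (v + h e) ∈ p ⁻¹' {p e} := by
    obtain ⟨_, x, rfl⟩ := v
    obtain ⟨γ, rfl⟩ := hsurj x
    change h.symm (h (M γ e₀) - h e + h e) ∈ _
    rw [sub_add_cancel, h.symm_apply_apply]
    exact (M γ e₀).2
  have hdisc : DiscreteTopology (LinearMap.range L) := by
    refine DiscreteTopology.of_continuous_injective
      (f := fun v : LinearMap.range L => (⟨h.symm (v + h e), hmem v⟩ : p ⁻¹' {p e})) ?_ ?_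
    · fun_prop
    · intro v w hvw
      exact Subtype.ext (add_right_cancel (h.symm.injective (congrArg Subtype.val hvw)))
  have hspan : Submodule.span ℤ (LinearMap.range L : Set ℂ) = LinearMap.range L :=
    Submodule.span_eq _
  have hfin := Real.finrank_eq_int_finrank_of_discrete (s := (LinearMap.range L : Set ℂ))
    (by rw [hspan]; exact hdisc)
  rw [Set.finrank, Set.finrank, hspan, LinearMap.finrank_range_of_inj hLinj] at hfin
  rw [← hfin, ← Complex.finrank_real_complex]
  exact Submodule.finrank_le _

end Covering

/-! ### Excluding the degenerate cases by genus -/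

section Developing

lemma t2Space_of_isSeparatedMap {X Y : Type*} [TopologicalSpace X] [TopologicalSpace Y] [T2Space Y]
    {f : X → Y} (h : IsSeparatedMap f) (hf : Continuous f) : T2Space X where
  t2 x y hxy := by
    by_cases e : f x = f y
    · exact h x y e hxy
    · obtain ⟨u, v, hu, hv, hxu, hyv, huv⟩ := t2_separation e
      exact ⟨_, _, hu.preimage hf, hv.preimage hf, hxu, hyv, huv.preimage f⟩

variable {S X : Type*} [TopologicalSpace S] [TopologicalSpace X] {p : X → S}

lemma locallyPathConnectedSpace_of_isLocalHomeomorph [LocallyPathConnectedSpace S]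
    (hp : IsLocalHomeomorph p) : LocallyPathConnectedSpace X := by
  choose e he _ using hp
  let _ : ChartedSpace S X :=
    { atlas := univ
      chartAt := e
      mem_chart_source := he
      chart_mem_atlas := fun _ => mem_univ _ }
  exact ChartedSpace.locallyPathConnectedSpace S X

/-- If the developing map is injective with image the complement of a point, the holonomy acts by
translations of `ℂ`. -/
lemma exists_homeomorph_deck_translation [ConnectedSpace X] (hp : IsCoveringMap p)
    (C : DevelopingPair p) (hinj : Function.Injective C.dev) {q : CP1}
    (hrange : range C.dev = {q}ᶜ) :
    ∃ h : X ≃ₜ ℂ, ∀ d ∈ deckGroup p, ∃ b, ∀ x, h (d x) = h x + b := by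
  obtain ⟨ψ, hψ, rfl⟩ := exists_mobius_infty q
  have hF := isLocalHomeomorph_mobius_comp (PSL2C.inv_mem hψ) C.isLocalHomeomorph_dev
  have hFi : Function.Injective (⇑ψ⁻¹ ∘ C.dev) := (ψ⁻¹).injective.comp hinj
  set F := ⇑ψ⁻¹ ∘ C.dev with hFdef
  have hFr : range F = {OnePoint.infty}ᶜ := by
    rw [hFdef, range_comp, hrange, image_compl_eq (ψ⁻¹).bijective, image_singleton]
    simp
  have hex (x : X) : ∃ z : ℂ, (z : CP1) = F x :=
    OnePoint.ne_infty_iff_exists.1 fun hx => by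
      have : F x ∈ range F := ⟨x, rfl⟩
      rw [hFr] at this
      exact this hx
  choose h hh using hex
  have hhi : Function.Injective h := fun x y hxy => hFi (by rw [← hh, ← hh, hxy])
  have hhs : Function.Surjective h := fun z => by
    have : (z : CP1) ∈ range F := by rw [hFr]; simp
    obtain ⟨x, hx⟩ := this
    exact ⟨x, OnePoint.coe_injective ((hh x).trans hx)⟩
  have hcomp : (fun z : ℂ => (z : CP1)) ∘ h = F := funext hh
  have hhc : Continuous h := by
    rw [OnePoint.isOpenEmbedding_coe.isInducing.continuous_iff]
    exact hcomp ▸ hF.continuous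
  have hho : IsOpenMap h := fun O hO => by
    rw [← OnePoint.isOpen_image_coe, ← image_comp]
    exact hcomp ▸ hF.isOpenMap O hO
  refine ⟨(Equiv.ofBijective h ⟨hhi, hhs⟩).toHomeomorphOfContinuousOpen hhc hho, fun d hd => ?_⟩
  change ∃ b, ∀ x, h (d x) = h x + b
  -- The holonomy, conjugated so that the omitted point is ∞, preserves the range of F and thus
  -- fixes ∞; it is affine.
  let μ : Equiv.Perm CP1 := ψ⁻¹ * (C.hol ⟨d, hd⟩ : Equiv.Perm CP1) * ψ
  have hμ : μ ∈ PSL2C := PSL2C.mul_mem (PSL2C.mul_mem (PSL2C.inv_mem hψ) (C.hol ⟨d, hd⟩).2) hψ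
  have hμF (x : X) : μ (F x) = F (d x) := by
    have := C.equivariant ⟨d, hd⟩ x
    simp only [μ, hFdef, Function.comp_apply, Equiv.Perm.mul_apply]
    rw [← Equiv.Perm.mul_apply ψ, mul_inv_cancel, Equiv.Perm.one_apply, ← this]
  have hμinf : μ OnePoint.infty = OnePoint.infty := by
    by_contra hne
    have : μ OnePoint.infty ∈ range F := by rw [hFr]; exact hne
    obtain ⟨y, hy⟩ := this
    have h1 := hμF (d.symm y)
    rw [d.apply_symm_apply, hy] at h1
    have h2 : F (d.symm y) ∈ range F := ⟨_, rfl⟩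
    rw [μ.injective h1, hFr] at h2
    exact h2 rfl
  obtain ⟨a, b, ha, hab⟩ := mobius_affine hμ hμinf
  have hd' (x : X) : h (d x) = a * h x + b := by
    have := hμF x
    rw [← hh, ← hh, hab] at this
    exact (OnePoint.coe_injective this).symm
  by_cases ha1 : a = 1
  · exact ⟨b, fun x => by rw [hd', ha1, one_mul]⟩
  -- An affine map with a ≠ 1 has the fixed point b/(1 − a), and a deck transformation with a fixed
  -- point is the identity.
  · obtain ⟨x, hx⟩ := hhs (b / (1 - a))
    have h1a : 1 - a ≠ 0 := sub_ne_zero.2 (Ne.symm ha1)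
    have hfix : d x = x := hhi (by
      rw [hd', hx]
      field_simp
      ring)
    have hid : ⇑d = id := hp.eq_of_comp_eq d.continuous continuous_id (funext hd) x hfix
    exact ⟨0, fun y => by rw [hid, id, add_zero]⟩

lemma not_compl_singleton_subset_image [T2Space S] [LocallyPathConnectedSpace S] {g : ℕ}
    (hg : 2 ≤ g) (hS : HasGenus S g) [T2Space X] [SimplyConnectedSpace X] (hp : IsCoveringMap p)
    (C : DevelopingPair p) {U : Set X} (hU : IsOpen U) (hi : InjOn C.dev U) (q : CP1) :
    ¬ {q}ᶜ ⊆ C.dev '' U := by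
  intro h
  have : LocallyPathConnectedSpace X :=
    locallyPathConnectedSpace_of_isLocalHomeomorph hp.isLocalHomeomorph
  obtain ⟨e⟩ : Nonempty X := inferInstance
  have hrank := hS (p e)
  rcases compactSpace_or_injective C.isLocalHomeomorph_dev hU hi h with hc | ⟨hinj, hr⟩
  · rw [finrank_abelianization_eq_zero hp e] at hrank
    omega
  · obtain ⟨h, ht⟩ := exists_homeomorph_deck_translation hp C hinj hr
    have := finrank_abelianization_le_two hp h ht e
    omega

end Developing

theorem mainTheorem6 {S X : Type*}
    [TopologicalSpace S] [T2Space S] [CompactSpace S] [ConnectedSpace S]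
    [ChartedSpace (EuclideanSpace ℝ (Fin 2)) S]
    (g : ℕ) (hg : 2 ≤ g) (hS : HasGenus S g)
    [TopologicalSpace X] [SimplyConnectedSpace X]
    (p : X → S) (hp : IsCoveringMap p)
    (C : DevelopingPair p) :
    (∀ D₁ ∈ maximalDisks C.dev, ∀ D₂ ∈ maximalDisks C.dev, D₁ ≠ D₂ →
      Disjoint (core C.dev D₁) (core C.dev D₂)) ∧
    (⋃ D ∈ maximalDisks C.dev, core C.dev D) = Set.univ := by
  have : LocallyPathConnectedSpace S :=
    ChartedSpace.locallyPathConnectedSpace (EuclideanSpace ℝ (Fin 2)) S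
  have : T2Space X := t2Space_of_isSeparatedMap hp.isSeparatedMap hp.continuous
  refine ⟨fun D₁ h₁ D₂ h₂ hne => disjoint_left.2 fun x hx₁ hx₂ =>
    hne (eq_of_mem_core C.isLocalHomeomorph_dev h₁.1 h₂.1 hx₁ hx₂), eq_univ_of_forall fun x => ?_⟩
  obtain ⟨D, hD, hx⟩ := exists_mem_core C.isLocalHomeomorph_dev
    (fun U hU hi q => not_compl_singleton_subset_image hg hS hp C hU hi q) x
  exact mem_biUnion hD hx
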